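/- Conventions. For a complex $N\times N$ matrix $M$ let $\|M\|_2=\sqrt{\mathrm{Tr}(M^*M)}$ (unnormalized trace) be the Frobenius norm and $\|M\|$ the operator norm. A Frobenius asymptotic representation of a countable group $\Gamma$ is a sequence of functions $\rho_i:\Gamma\to U(N_i)$ with $\|\rho_i(xy)-\rho_i(x)\rho_i(y)\|_2\to 0$ for all $x,y\in\Gamma$. It is perturbable to genuine representations in the Frobenius (resp. operator) norm if there are unitary representations $\pi_i:\Gamma\to U(N_i)$ with $\|\pi_i(x)-\rho_i(x)\|_2\to 0$ (resp. $\|\pi_i(x)-\rho_i(x)\|\to 0$) for all $x\in\Gamma$. The group $\Gamma$ is Frobenius stable if every Frobenius asymptotic representation of $\Gamma$ is perturbable in the Frobenius norm. Cohomology has coefficients in $\mathbb{Z}$ with trivial action. For $\alpha\in\mathrm{Hom}(\Gamma,\mathbb{Z})$, a class in $H^2(\Gamma)$ is skinny with respect to $\alpha$ if its restriction to $\ker\alpha$ is zero. A Mal'cev basis of $\Gamma$ is a tuple $(a_1,\dots,a_m)$ such that every $g\in\Gamma$ is uniquely of the form $g=a_1^{x_1}\cdots a_m^{x_m}$ with $x=(x_1,\dots,x_m)\in\mathbb{Z}^m$,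 and such that the subgroups $\langle a_i,\dots,a_m\rangle$ form a central series of $\Gamma$; we then identify $g$ with $x$. If $m\ge 1$, the canonical homomorphism of the basis is $\alpha(x)=x_1$. Theorem. Let $\Gamma$ be a finitely generated torsion-free nilpotent group. (1) If some non-torsion class in $H^2(\Gamma)$ is skinny with respect to some $\alpha\in\mathrm{Hom}(\Gamma,\mathbb{Z})$, then $\Gamma$ is not Frobenius stable. (2) Let $a_1,\dots,a_m$ ($m\ge 1$) be a Mal'cev basis of $\Gamma$, and let $c\in H^2(\Gamma)$ be a non-torsion class that is skinny with respect to the canonical homomorphism. Then $c$ has a normalized cocycle representative $\sigma$ of the form $\sigma(x,y)=p(x_1,\dots,x_m,y_1)$ with $p\in\mathbb{Q}[x_1,\dots,x_m,y_1]$. Moreover, let $\sigma$ be any cocycle representative of $c$ of this form, with polynomial $p$. Then for every integer $n\ge 1$ coprime to the denominators of the coefficients of $p$ the formula $$\rho_n(x)\,\delta_{\bar j}=\exp\Bigl(\tfrac{2\pi i}{n}\,p(x_1,\dots,x_m,j)\Bigr)\,\delta_{\bar j+\bar x_1}\qquad(x\in\Gamma,\ j\in\mathbb{Z})$$ gives a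 well-defined map $\rho_n:\Gamma\to U(\ell^2(\mathbb{Z}/n\mathbb{Z}))$, where $\bar{\ }$ is reduction modulo $n$ and $(\delta_{\bar j})$ is the standard basis. Along every strictly increasing sequence of such $n$, the maps $\rho_n$ form a Frobenius asymptotic representation that is not perturbable to genuine representations in the Frobenius norm, nor even in the operator norm. -/

import Mathlib

open Filter Topology

noncomputable section

namespace SkinnyClass

/-! ### Norms and Frobenius stability -/

/-- The Frobenius norm `‖M‖₂ = √Tr(M* M)`, with the unnormalized trace. -/
def frobNorm {ι : Type*} [Fintype ι] (M : Matrix ι ι ℂ) : ℝ :=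
  Real.sqrt (Matrix.trace (M.conjTranspose * M)).re

/-- The operator norm of a square matrix acting on the Hilbert space `ℓ²(ι)`. -/
def opNorm {ι : Type*} [Fintype ι] [DecidableEq ι] (M : Matrix ι ι ℂ) : ℝ :=
  ‖Matrix.toEuclideanCLM (n := ι) (𝕜 := ℂ) M‖

section Stability

variable {Γ : Type*} [Group Γ] {ι : ℕ → Type*} [∀ i, Fintype (ι i)] [∀ i, DecidableEq (ι i)]

/-- A sequence of functions into finite-dimensional unitary groups is a Frobenius asymptotic
representation if it is asymptotically multiplicative in the Frobenius norm. -/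
def IsFrobeniusAsymptoticRep (ρ : ∀ i, Γ → Matrix.unitaryGroup (ι i) ℂ) : Prop :=
  ∀ x y : Γ, Tendsto
    (fun i => frobNorm ((ρ i (x * y)).1 - (ρ i x).1 * (ρ i y).1)) atTop (𝓝 0)

/-- The sequence is perturbable in the Frobenius norm to genuine unitary representations. -/
def IsFrobeniusPerturbable (ρ : ∀ i, Γ → Matrix.unitaryGroup (ι i) ℂ) : Prop :=
  ∃ π : ∀ i, Γ →* Matrix.unitaryGroup (ι i) ℂ, ∀ x : Γ, Tendsto
    (fun i => frobNorm ((π i x).1 - (ρ i x).1)) atTop (𝓝 0)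

/-- The sequence is perturbable in the operator norm to genuine unitary representations. -/
def IsOpNormPerturbable (ρ : ∀ i, Γ → Matrix.unitaryGroup (ι i) ℂ) : Prop :=
  ∃ π : ∀ i, Γ →* Matrix.unitaryGroup (ι i) ℂ, ∀ x : Γ, Tendsto
    (fun i => opNorm ((π i x).1 - (ρ i x).1)) atTop (𝓝 0)

end Stability

/-- `Γ` is Frobenius stable if every Frobenius asymptotic representation is perturbable in the
Frobenius norm to a sequence of genuine representations. -/
def FrobeniusStable (Γ : Type*) [Group Γ] : Prop :=
  ∀ (N : ℕ → ℕ) (ρ : ∀ i, Γ → Matrix.unitaryGroup (Fin (N i)) ℂ),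
    IsFrobeniusAsymptoticRep ρ → IsFrobeniusPerturbable ρ

/-! ### Mal'cev bases -/

section Malcev

variable {Γ : Type*} [Group Γ] {m : ℕ}

/-- The element `a₁ ^ x₁ ⋯ aₘ ^ xₘ`. -/
def canonicalForm (a : Fin m → Γ) (x : Fin m → ℤ) : Γ :=
  (List.ofFn fun i => a i ^ x i).prod

/-- A Mal'cev basis: every element has a unique canonical form, and the subgroups generated by the
tails of `a` form a central series (it reaches the trivial group at step `m`). -/
structure IsMalcevBasis (a : Fin m → Γ) : Prop where
  existsUnique_form : ∀ g : Γ, ∃! x : Fin m → ℤ, g = canonicalForm a x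
  central : Subgroup.IsDescendingCentralSeries fun i : ℕ =>
    Subgroup.closure {g : Γ | ∃ j : Fin m, i ≤ (j : ℕ) ∧ g = a j}

/-- `α` is the canonical homomorphism `a₁ ^ x₁ ⋯ aₘ ^ xₘ ↦ x₁` with respect to `a`. -/
def IsCanonicalHom (a : Fin (m + 1) → Γ) (α : Γ →* Multiplicative ℤ) : Prop :=
  ∀ x : Fin (m + 1) → ℤ, α (canonicalForm a x) = Multiplicative.ofAdd (x 0)

end Malcev

/-! ### Skinny cohomology classes -/

/-- `ℤ` with the trivial action of `Γ`. -/
abbrev trivialInt (Γ : Type) [Group Γ] : Rep ℤ Γ := Rep.trivial ℤ Γ ℤ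

/-- The identity of `ℤ`, from the restriction along `f` of the trivial module to the trivial module. -/
def resTrivialInt {Γ Λ : Type} [Group Γ] [Group Λ] (f : Γ →* Λ) :
    Rep.res f (trivialInt Λ) ⟶ trivialInt Γ :=
  Rep.ofHom ⟨LinearMap.id, fun _ => rfl⟩

/-- The map `f^* : H²(Λ; ℤ) → H²(Γ; ℤ)` induced by a group homomorphism `f : Γ → Λ`. -/
def H2pullback {Γ Λ : Type} [Group Γ] [Group Λ] (f : Γ →* Λ) :
    groupCohomology.H2 (trivialInt Λ) → groupCohomology.H2 (trivialInt Γ) :=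
  groupCohomology.map f (resTrivialInt f) 2

section Skinny

variable {Γ : Type} [Group Γ] {m : ℕ}

/-- `c` is skinny with respect to `α` if its restriction to `ker α` vanishes. -/
def IsSkinny (α : Γ →* Multiplicative ℤ) (c : groupCohomology.H2 (trivialInt Γ)) : Prop :=
  H2pullback α.ker.subtype c = 0

/-- The integer value `σ(g, h)` of a 2-cocycle. -/
def cocycleVal (σ : groupCohomology.cocycles₂ (trivialInt Γ)) (g h : Γ) : ℤ := σ (g, h)

/-- A 2-cocycle is normalized if it vanishes as soon as one of its arguments is trivial. -/
def IsNormalized (σ : groupCohomology.cocycles₂ (trivialInt Γ)) : Prop :=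
  ∀ g : Γ, cocycleVal σ g 1 = 0 ∧ cocycleVal σ 1 g = 0

/-- The value `p(x₁, …, xₘ, j)` at integers of a polynomial in `x₁, …, xₘ` (indexed by `some`) and
one further variable `y₁` (indexed by `none`). -/
def polyVal (p : MvPolynomial (Option (Fin (m + 1))) ℚ) (x : Fin (m + 1) → ℤ) (j : ℤ) : ℚ :=
  MvPolynomial.eval (fun o : Option (Fin (m + 1)) => o.elim (j : ℚ) fun i => (x i : ℚ)) p

/-- `σ` is given by the polynomial `p` in Mal'cev coordinates: `σ(x, y) = p(x₁, …, xₘ, y₁)`. -/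
def IsGivenBy (a : Fin (m + 1) → Γ) (σ : groupCohomology.cocycles₂ (trivialInt Γ))
    (p : MvPolynomial (Option (Fin (m + 1))) ℚ) : Prop :=
  ∀ x y : Fin (m + 1) → ℤ,
    (cocycleVal σ (canonicalForm a x) (canonicalForm a y) : ℚ) = polyVal p x (y 0)

/-- `n` is coprime to the denominators of all coefficients of `p`. -/
def CoprimeToDenominators (p : MvPolynomial (Option (Fin (m + 1))) ℚ) (n : ℕ) : Prop :=
  ∀ s, Nat.Coprime n (p.coeff s).den

/-- `ρ : Γ → U(ℓ²(ℤ/n))` satisfies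
`ρ(x) δ_j = exp((2πi/n) p(x₁, …, xₘ, j)) δ_{j + x₁}` for all `x ∈ Γ` and all integers `j`, where the
indices of the standard basis vectors are reduced modulo `n`. -/
def IsCocycleMap (a : Fin (m + 1) → Γ) (p : MvPolynomial (Option (Fin (m + 1))) ℚ)
    (n : ℕ) [NeZero n] (ρ : Γ → Matrix.unitaryGroup (ZMod n) ℂ) : Prop :=
  ∀ (x : Fin (m + 1) → ℤ) (j : ℤ),
    (ρ (canonicalForm a x) : Matrix (ZMod n) (ZMod n) ℂ).mulVec (Pi.single (j : ZMod n) 1) =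
      Complex.exp (2 * Real.pi * Complex.I / n * (polyVal p x j : ℂ)) •
        Pi.single ((j : ZMod n) + (x 0 : ZMod n)) (1 : ℂ)

end Skinny

end SkinnyClass

end

/-! A skinny class defines a central extension of `Γ` by `ℤ` that splits over `ker α` by a
homomorphism `s`. After dividing a nonzero `α` by the generator of its image, take `a` with `α a =
1` and a lift `t` of `a`. Conjugation by `t` acts on `ker α` by an automorphism `ψ` and changes `s`
by a homomorphism `h : ker α → ℤ`. For the section `a ^ k * x ↦ t ^ k * s x`, the cocycle at `(a ^ k
* x, a ^ l * y)` is therefore `(h + ψ* h + ⋯ + ψ*ˡ⁻¹ h)(x)` for `l ≥ 0`. Nilpotency of `Γ` kills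
high powers of `ψ* - 1` on `h`, so Newton's formula makes this a polynomial in `l`
(`exists_newton_cocycle`). For `n` coprime to the denominators, `σ(g, ·)` modulo `n` depends only on
`α` modulo `n`, and weighted shifts give an `n`-dimensional projective representation with cocycle
`exp (2πi σ / n)` (`mul_eq_scalarUnitary_mul`). Its Frobenius defect is `O(1/√n)`.

If representations `π` were close to `ρ` in operator norm, the unitaries `π(x)⁻¹ ρ(x)` would be near
`1` and have a total phase, the trace of their principal logarithm over `i`. Near `1` the phase is
additive and conjugation invariant, and the scalar `exp (2πi σ / n)` contributes exactly `2πσ` in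
dimension `n`. So the phases divided by `2π` solve any finite set of the equations for a primitive
of `σ` (`phase_add_eq`). Linear algebra then gives a rational primitive (`exists_rat_primitive`),
finite generation bounds its denominators (`exists_int_primitive`), and the class is torsion. -/

namespace SkinnyClass

/-! ### The total phase of a unitary near the identity. -/

section UnitaryPhase

open scoped Matrix.Norms.L2Operator
open Unitary selfAdjoint Matrix

variable {ι : Type*} [Fintype ι] [DecidableEq ι]

/-- A continuous real function with values in `2πℤ` on `[0, 1]` that vanishes at `0`
vanishes at `1`. -/
theorem eq_zero_of_exp_mul_I_eq_one {f : ℝ → ℝ} (hf : ContinuousOn f (Set.Icc 0 1))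
    (hexp : ∀ t ∈ Set.Icc (0 : ℝ) 1, Complex.exp (f t * Complex.I) = 1) (h0 : f 0 = 0) :
    f 1 = 0 := by
  by_contra h1
  have hintegral : ∀ t ∈ Set.Icc (0 : ℝ) 1, ∃ k : ℤ, f t = k * (2 * Real.pi) := by
    intro t ht
    obtain ⟨k, hk⟩ := Complex.exp_eq_one_iff.1 (hexp t ht)
    refine ⟨k, ?_⟩
    have h2 : (f t : ℂ) = ((k * (2 * Real.pi) : ℝ) : ℂ) := by
      apply mul_right_cancel₀ Complex.I_ne_zero
      rw [hk]; push_cast; ring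
    exact_mod_cast h2
  have hpi := Real.pi_pos
  obtain ⟨k, hk⟩ := hintegral 1 (by simp)
  have hsub : Set.uIcc (f 0) (f 1) ⊆ f '' Set.uIcc 0 1 :=
    intermediate_value_uIcc (by simpa [Set.uIcc_of_le] using hf)
  have hk0 : k ≠ 0 := by rintro rfl; simp [hk] at h1
  -- As `f 1 = 2πk`, this intermediate value is `±π`, which is not in `2πℤ`.
  have hmem : f 1 / (2 * |(k : ℝ)|) ∈ Set.uIcc (f 0) (f 1) := by
    have h3 : (1 : ℝ) ≤ |(k : ℝ)| := by exact_mod_cast Int.one_le_abs hk0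
    have h4 : 0 ≤ 1 / (2 * |(k : ℝ)|) := by positivity
    have h5 : 1 / (2 * |(k : ℝ)|) ≤ 1 := by
      rw [div_le_one (by positivity)]; linarith
    rw [h0, Set.mem_uIcc, div_eq_mul_one_div]
    rcases le_total 0 (f 1) with h | h
    · left; constructor <;> nlinarith
    · right; constructor <;> nlinarith
  obtain ⟨t, ht, hft⟩ := hsub hmem
  obtain ⟨l, hl⟩ := hintegral t (by simpa [Set.uIcc_of_le] using ht)
  rw [hl, hk] at hft
  have h3 : (0 : ℝ) < |(k : ℝ)| := by positivity
  have h6 : (2 * l * |k| : ℝ) = k := by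
    field_simp at hft
    push_cast
    linarith
  have h7 : 2 * l * |k| = k := by exact_mod_cast h6
  rcases abs_choice k with h | h <;> rw [h] at h7
  · have : (2 * l - 1) * k = 0 := by linarith
    rcases mul_eq_zero.1 this with h | h
    · omega
    · exact hk0 h
  · have : (2 * l + 1) * k = 0 := by linarith
    rcases mul_eq_zero.1 this with h | h
    · omega
    · exact hk0 h

/-- The total phase of a unitary matrix: the trace of the principal branch of its argument. -/
noncomputable def phase (u : unitary (Matrix ι ι ℂ)) : ℝ :=
  (Matrix.trace (argSelfAdjoint u : Matrix ι ι ℂ)).re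

theorem continuousOn_phase :
    ContinuousOn (phase : unitary (Matrix ι ι ℂ) → ℝ) (Metric.ball 1 2) := by
  have h : Continuous fun x : selfAdjoint (Matrix ι ι ℂ) => (Matrix.trace (x : Matrix ι ι ℂ)).re := by
    fun_prop
  exact h.comp_continuousOn continuousOn_argSelfAdjoint

theorem det_exp_I_smul {A : Matrix ι ι ℂ} (hA : A.IsHermitian) :
    (NormedSpace.exp (Complex.I • A)).det = Complex.exp (A.trace * Complex.I) := by
  set U : Matrix ι ι ℂ := hA.eigenvectorUnitary.1 with hU
  have hUU : star U * U = 1 := Unitary.coe_star_mul_self hA.eigenvectorUnitary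
  have hUinv : U⁻¹ = star U := Matrix.inv_eq_left_inv hUU
  have hunit : IsUnit U := (Matrix.isUnit_iff_isUnit_det _).2 (Matrix.isUnit_det_of_left_inverse hUU)
  have hspec : Complex.I • A =
      U * diagonal (fun j => Complex.I * (hA.eigenvalues j : ℂ)) * U⁻¹ := by
    conv_lhs => rw [hA.spectral_theorem, conjStarAlgAut_apply]
    rw [hUinv, ← smul_mul_assoc, ← mul_smul_comm, ← diagonal_smul]
    rfl
  rw [hspec, Matrix.exp_conj _ _ hunit, Matrix.det_conj hunit, Matrix.exp_diagonal, det_diagonal,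
    hA.trace_eq_sum_eigenvalues, Finset.sum_mul, Complex.exp_sum]
  refine Finset.prod_congr rfl fun j _ => ?_
  rw [Pi.coe_exp, ← Complex.exp_eq_exp_ℂ, mul_comm]
  rfl

theorem mem_ball_of_norm_sub_one_lt {u : unitary (Matrix ι ι ℂ)} {r : ℝ}
    (hu : ‖(u - 1 : Matrix ι ι ℂ)‖ < r) : u ∈ Metric.ball (1 : unitary (Matrix ι ι ℂ)) r := by
  rwa [Metric.mem_ball, Subtype.dist_eq, dist_eq_norm]

/-- Multiplicativity of the determinant thus controls phases modulo `2π`; continuity along paths to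
`1` removes the ambiguity. -/
theorem exp_phase {u : unitary (Matrix ι ι ℂ)} (hu : ‖(u - 1 : Matrix ι ι ℂ)‖ < 2) :
    Complex.exp (phase u * Complex.I) = (u : Matrix ι ι ℂ).det := by
  have hH : (argSelfAdjoint u : Matrix ι ι ℂ).IsHermitian := (argSelfAdjoint u).2
  have htr : ((phase u : ℝ) : ℂ) = (argSelfAdjoint u : Matrix ι ι ℂ).trace := by
    rw [phase, hH.trace_eq_sum_eigenvalues]
    simp
  rw [htr, ← det_exp_I_smul hH]
  conv_rhs => rw [← expUnitary_argSelfAdjoint hu, expUnitary_coe]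

theorem phase_expUnitary {x : selfAdjoint (Matrix ι ι ℂ)} (hx : ‖x‖ < Real.pi) :
    phase (expUnitary x) = (Matrix.trace (x : Matrix ι ι ℂ)).re := by
  rw [phase, argSelfAdjoint_expUnitary hx]

theorem phase_one : phase (1 : unitary (Matrix ι ι ℂ)) = 0 := by
  rw [← expUnitary_zero, phase_expUnitary (by simpa using Real.pi_pos)]
  simp

/-- The phase is additive near `1`, as one sees by contracting both factors to `1`. -/
theorem phase_mul_of_norm_lt {v w : unitary (Matrix ι ι ℂ)}
    (hv : ‖(v - 1 : Matrix ι ι ℂ)‖ < 1) (hw : ‖(w - 1 : Matrix ι ι ℂ)‖ < 1) :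
    phase (v * w) = phase v + phase w := by
  have hv2 : ‖(v - 1 : Matrix ι ι ℂ)‖ < 2 := by linarith
  have hw2 : ‖(w - 1 : Matrix ι ι ℂ)‖ < 2 := by linarith
  set V : ℝ → unitary (Matrix ι ι ℂ) := fun t => expUnitary (t • argSelfAdjoint v) with hV
  set W : ℝ → unitary (Matrix ι ι ℂ) := fun t => expUnitary (t • argSelfAdjoint w) with hW
  have hVc : Continuous V := by fun_prop
  have hWc : Continuous W := by fun_prop
  have hVb : ∀ t ∈ Set.Icc (0 : ℝ) 1, ‖(V t - 1 : Matrix ι ι ℂ)‖ < 1 := fun t ht =>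
    (norm_expUnitary_smul_argSelfAdjoint_sub_one_le v ht hv2).trans_lt hv
  have hWb : ∀ t ∈ Set.Icc (0 : ℝ) 1, ‖(W t - 1 : Matrix ι ι ℂ)‖ < 1 := fun t ht =>
    (norm_expUnitary_smul_argSelfAdjoint_sub_one_le w ht hw2).trans_lt hw
  -- Radius `1` for each factor keeps the product within radius `2`, where the phase is continuous.
  have hVWb : ∀ t ∈ Set.Icc (0 : ℝ) 1, ‖((V t * W t : unitary _) - 1 : Matrix ι ι ℂ)‖ < 2 := by
    intro t ht
    have h1 : ((V t * W t : unitary _) - 1 : Matrix ι ι ℂ) =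
        (V t : Matrix ι ι ℂ) * (W t - 1) + (V t - 1) := by
      push_cast; noncomm_ring
    have h2 : ‖(V t : Matrix ι ι ℂ) * (W t - 1)‖ = ‖(W t - 1 : Matrix ι ι ℂ)‖ :=
      CStarRing.norm_coe_unitary_mul _ _
    rw [h1]
    refine (norm_add_le _ _).trans_lt ?_
    rw [h2]
    linarith [hVb t ht, hWb t ht]
  have key : phase (V 1 * W 1) - phase (V 1) - phase (W 1) = 0 := by
    refine eq_zero_of_exp_mul_I_eq_one (f := fun t => phase (V t * W t) - phase (V t) - phase (W t))
      ?_ ?_ ?_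
    · refine ((continuousOn_phase.comp (hVc.mul hWc).continuousOn ?_).sub
        (continuousOn_phase.comp hVc.continuousOn ?_)).sub
        (continuousOn_phase.comp hWc.continuousOn ?_)
      · exact fun t ht => mem_ball_of_norm_sub_one_lt (hVWb t ht)
      · exact fun t ht => mem_ball_of_norm_sub_one_lt ((hVb t ht).trans one_lt_two)
      · exact fun t ht => mem_ball_of_norm_sub_one_lt ((hWb t ht).trans one_lt_two)
    · intro t ht
      have hd : ((V t : Matrix ι ι ℂ).det * (W t : Matrix ι ι ℂ).det) ≠ 0 := by
        rw [← exp_phase ((hVb t ht).trans one_lt_two), ← exp_phase ((hWb t ht).trans one_lt_two)]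
        exact mul_ne_zero (Complex.exp_ne_zero _) (Complex.exp_ne_zero _)
      push_cast
      rw [sub_mul, sub_mul, Complex.exp_sub, Complex.exp_sub, exp_phase (hVWb t ht),
        exp_phase ((hVb t ht).trans one_lt_two), exp_phase ((hWb t ht).trans one_lt_two),
        div_div, div_eq_one_iff_eq hd]
      simp
    · simp [hV, hW, phase_one]
  have hV1 : V 1 = v := by simp [hV, expUnitary_argSelfAdjoint hv2]
  have hW1 : W 1 = w := by simp [hW, expUnitary_argSelfAdjoint hw2]
  rw [hV1, hW1] at key
  linarith

theorem norm_conj_sub_one (g v : unitary (Matrix ι ι ℂ)) :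
    ‖((g⁻¹ * v * g : unitary _) - 1 : Matrix ι ι ℂ)‖ = ‖(v - 1 : Matrix ι ι ℂ)‖ := by
  have h : ((g⁻¹ * v * g : unitary _) - 1 : Matrix ι ι ℂ) =
      ((g⁻¹ : unitary (Matrix ι ι ℂ)) : Matrix ι ι ℂ) * (v - 1) * g := by
    have h1 : ((g⁻¹ : unitary (Matrix ι ι ℂ)) : Matrix ι ι ℂ) * (g : Matrix ι ι ℂ) = 1 := by
      rw [← Submonoid.coe_mul, inv_mul_cancel, Submonoid.coe_one]
    rw [mul_sub, sub_mul, mul_one, h1]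
    push_cast
    rfl
  rw [h, CStarRing.norm_mul_coe_unitary, CStarRing.norm_coe_unitary_mul]

/-- The same contraction to `1` applies, since conjugation preserves both the determinant and the
distance to `1`. -/
theorem phase_conj (g : unitary (Matrix ι ι ℂ)) {v : unitary (Matrix ι ι ℂ)}
    (hv : ‖(v - 1 : Matrix ι ι ℂ)‖ < 2) :
    phase (g⁻¹ * v * g) = phase v := by
  set V : ℝ → unitary (Matrix ι ι ℂ) := fun t => expUnitary (t • argSelfAdjoint v) with hV
  have hVc : Continuous V := by fun_prop
  have hVb : ∀ t ∈ Set.Icc (0 : ℝ) 1, ‖(V t - 1 : Matrix ι ι ℂ)‖ < 2 := fun t ht =>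
    (norm_expUnitary_smul_argSelfAdjoint_sub_one_le v ht hv).trans_lt hv
  have key : phase (g⁻¹ * V 1 * g) - phase (V 1) = 0 := by
    refine eq_zero_of_exp_mul_I_eq_one (f := fun t => phase (g⁻¹ * V t * g) - phase (V t)) ?_ ?_ ?_
    · refine (continuousOn_phase.comp (by fun_prop) ?_).sub
        (continuousOn_phase.comp hVc.continuousOn ?_)
      · exact fun t ht => mem_ball_of_norm_sub_one_lt (by rw [norm_conj_sub_one]; exact hVb t ht)
      · exact fun t ht => mem_ball_of_norm_sub_one_lt (hVb t ht)
    · intro t ht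
      have hd : (V t : Matrix ι ι ℂ).det ≠ 0 := by
        rw [← exp_phase (hVb t ht)]
        exact Complex.exp_ne_zero _
      have hdet : ((g⁻¹ * V t * g : unitary _) : Matrix ι ι ℂ).det = (V t : Matrix ι ι ℂ).det := by
        have h1 : ((g⁻¹ : unitary (Matrix ι ι ℂ)) : Matrix ι ι ℂ).det *
            (g : Matrix ι ι ℂ).det = 1 := by
          rw [← det_mul, ← Submonoid.coe_mul, inv_mul_cancel, Submonoid.coe_one, det_one]
        rw [Submonoid.coe_mul, Submonoid.coe_mul, det_mul, det_mul, mul_right_comm, h1, one_mul]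
      push_cast
      rw [sub_mul, Complex.exp_sub, exp_phase (hVb t ht),
        exp_phase (by rw [norm_conj_sub_one]; exact hVb t ht), div_eq_one_iff_eq hd, hdet]
    · simp [hV, phase_one]
  have hV1 : V 1 = v := by simp [hV, expUnitary_argSelfAdjoint hv]
  rw [hV1] at key
  linarith

/-- The scalar matrix `exp (i s)` as a unitary. -/
noncomputable def scalarUnitary (ι : Type*) [Fintype ι] [DecidableEq ι] (s : ℝ) :
    unitary (Matrix ι ι ℂ) :=
  expUnitary (s • (1 : selfAdjoint (Matrix ι ι ℂ)))

theorem coe_scalarUnitary (s : ℝ) :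
    (scalarUnitary ι s : Matrix ι ι ℂ) = Complex.exp (s * Complex.I) • 1 := by
  have h : Complex.I • ((s • (1 : selfAdjoint (Matrix ι ι ℂ)) : selfAdjoint _) : Matrix ι ι ℂ) =
      diagonal (fun _ => (s * Complex.I : ℂ)) := by
    ext i j
    by_cases hij : i = j <;> simp [hij, mul_comm]
  rw [scalarUnitary, expUnitary_coe, h, Matrix.exp_diagonal, ← diagonal_one, ← diagonal_smul]
  congr 1
  ext i
  rw [Pi.coe_exp, ← Complex.exp_eq_exp_ℂ]
  simp

theorem norm_scalarUnitary_sub_one_le (s : ℝ) :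
    ‖(scalarUnitary ι s - 1 : Matrix ι ι ℂ)‖ ≤ |s| := by
  have h : (scalarUnitary ι s - 1 : Matrix ι ι ℂ) = (Complex.exp (s * Complex.I) - 1) • 1 := by
    rw [coe_scalarUnitary, sub_smul, one_smul]
  rw [h, norm_smul]
  have h1 : ‖Complex.exp (s * Complex.I) - 1‖ ≤ |s| := by
    have := Real.norm_exp_I_mul_ofReal_sub_one_le (x := s)
    rwa [mul_comm, Real.norm_eq_abs] at this
  have h2 : ‖(1 : Matrix ι ι ℂ)‖ ≤ 1 := by
    cases isEmpty_or_nonempty ι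
    · rw [Subsingleton.elim (1 : Matrix ι ι ℂ) 0]; simp
    · simp
  calc _ ≤ |s| * 1 := mul_le_mul h1 h2 (norm_nonneg _) (abs_nonneg _)
    _ = |s| := mul_one _

/-- The factor `card ι` cancels the denominator in `s = 2πσ / card ι`, so the cocycle value is
recovered exactly. -/
theorem phase_scalarUnitary {s : ℝ} (hs : |s| < Real.pi) :
    phase (scalarUnitary ι s) = Fintype.card ι * s := by
  rw [scalarUnitary, phase_expUnitary]
  · simp [trace_smul, mul_comm]
  · rw [norm_smul, Real.norm_eq_abs]
    refine lt_of_le_of_lt ?_ hs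
    have h2 : ‖(1 : selfAdjoint (Matrix ι ι ℂ))‖ ≤ 1 := by
      change ‖(1 : Matrix ι ι ℂ)‖ ≤ 1
      cases isEmpty_or_nonempty ι
      · rw [Subsingleton.elim (1 : Matrix ι ι ℂ) 0]; simp
      · simp
    exact mul_le_of_le_one_right (abs_nonneg _) h2

end UnitaryPhase

/-! ### From nearby representations to a primitive of a multiple of the cocycle. -/

section Obstruction

open scoped Matrix.Norms.L2Operator

variable {Γ : Type*} [Group Γ]

/-- If genuine representations approximate a projective representation with cocycle
`exp (2πi σ / N)` closely enough, the phases of the difference are a primitive of `σ`. -/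
theorem phase_add_eq {ι : Type*} [Fintype ι] [DecidableEq ι] [Nonempty ι] {σ : ℤ} {x y : Γ}
    {ρ : Γ → Matrix.unitaryGroup ι ℂ} {π : Γ →* Matrix.unitaryGroup ι ℂ}
    (hmul : ρ x * ρ y = scalarUnitary ι (2 * Real.pi * σ / Fintype.card ι) * ρ (x * y))
    (hσ : |2 * Real.pi * σ / Fintype.card ι| < 1)
    (hx : opNorm ((π x).1 - (ρ x).1) < 1) (hy : opNorm ((π y).1 - (ρ y).1) < 1)
    (hxy : opNorm ((π (x * y)).1 - (ρ (x * y)).1) < 1) :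
    phase ((π x)⁻¹ * ρ x) + phase ((π y)⁻¹ * ρ y) =
      2 * Real.pi * σ + phase ((π (x * y))⁻¹ * ρ (x * y)) := by
  have hnorm : ∀ g : Γ, opNorm ((π g).1 - (ρ g).1) < 1 →
      ‖(((π g)⁻¹ * ρ g : unitary _) - 1 : Matrix ι ι ℂ)‖ < 1 := by
    intro g hg
    have h1 : (((π g)⁻¹ * ρ g : unitary _) - 1 : Matrix ι ι ℂ) =
        (((π g)⁻¹ : unitary (Matrix ι ι ℂ)) : Matrix ι ι ℂ) * ((ρ g).1 - (π g).1) := by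
      rw [mul_sub, ← Submonoid.coe_mul, ← Submonoid.coe_mul, inv_mul_cancel, Submonoid.coe_one]
    rw [h1, CStarRing.norm_coe_unitary_mul, norm_sub_rev]
    exact hg
  set s := scalarUnitary ι (2 * Real.pi * σ / Fintype.card ι) with hs
  have hcomm : ∀ w : unitary (Matrix ι ι ℂ), w * s = s * w := by
    intro w
    ext1
    rw [Submonoid.coe_mul, Submonoid.coe_mul, hs, coe_scalarUnitary, mul_smul_comm, smul_mul_assoc,
      mul_one, one_mul]
  -- With `u_g = π(g)⁻¹ ρ(g)`, a conjugate of `u_x` times `u_y` is the scalar times `u_{xy}`; taking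
  -- phases gives the claim.
  have hid : ((π y)⁻¹ * ((π x)⁻¹ * ρ x) * π y) * ((π y)⁻¹ * ρ y) =
      s * ((π (x * y))⁻¹ * ρ (x * y)) := by
    calc _ = (π y)⁻¹ * (π x)⁻¹ * (ρ x * ρ y) := by group
      _ = (π (x * y))⁻¹ * s * ρ (x * y) := by rw [hmul, map_mul, mul_inv_rev, mul_assoc _ s]
      _ = _ := by rw [hcomm, mul_assoc]
  have hphase := congrArg phase hid
  rw [phase_mul_of_norm_lt (by rw [norm_conj_sub_one]; exact hnorm x hx) (hnorm y hy),
    phase_conj _ ((hnorm x hx).trans one_lt_two),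
    phase_mul_of_norm_lt ((norm_scalarUnitary_sub_one_le _).trans_lt hσ) (hnorm _ hxy),
    phase_scalarUnitary (hσ.trans (by linarith [Real.pi_gt_three]))] at hphase
  rw [hphase, mul_div_cancel₀]
  exact_mod_cast Fintype.card_ne_zero

/-- A system of equations `τ x + τ y - τ (x y) = σ x y` is solvable in rationals if each of its
finite subsystems is solvable in reals. -/
theorem exists_rat_primitive {σ : Γ → Γ → ℤ} {τ : ℕ → Γ → ℝ}
    (hτ : ∀ x y, ∀ᶠ i in atTop, τ i x + τ i y - τ i (x * y) = σ x y) :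
    ∃ t : Γ → ℚ, ∀ x y, t x + t y - t (x * y) = σ x y := by
  set F : (Γ × Γ →₀ ℚ) →ₗ[ℚ] (Γ →₀ ℚ) := Finsupp.linearCombination ℚ fun z : Γ × Γ =>
    Finsupp.single z.1 (1 : ℚ) + Finsupp.single z.2 1 - Finsupp.single (z.1 * z.2) 1 with hF
  set S : (Γ × Γ →₀ ℚ) →ₗ[ℚ] ℚ := Finsupp.linearCombination ℚ fun z : Γ × Γ => (σ z.1 z.2 : ℚ)
    with hS
  -- A rational relation among the left-hand sides involves finitely many equations. A real solution
  -- of these shows that the right-hand sides satisfy it too.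
  have hker : LinearMap.ker F ≤ LinearMap.ker S := by
    intro c hc
    rw [LinearMap.mem_ker] at hc ⊢
    have hev : ∀ᶠ i in atTop, ∀ z ∈ c.support, τ i z.1 + τ i z.2 - τ i (z.1 * z.2) = σ z.1 z.2 :=
      (Filter.eventually_all_finset _).2 fun z _ => hτ z.1 z.2
    obtain ⟨i, hi⟩ := hev.exists
    have h1 : Finsupp.linearCombination ℚ (τ i) (F c) = ((S c : ℚ) : ℝ) := by
      have hFc : F c = ∑ z ∈ c.support, c z • (Finsupp.single z.1 (1 : ℚ) +
          Finsupp.single z.2 1 - Finsupp.single (z.1 * z.2) 1) :=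
        Finsupp.linearCombination_apply ℚ c
      have hSc : S c = ∑ z ∈ c.support, c z • (σ z.1 z.2 : ℚ) :=
        Finsupp.linearCombination_apply ℚ c
      rw [hFc, hSc, map_sum, Rat.cast_sum]
      refine Finset.sum_congr rfl fun z hz => ?_
      simp only [map_smul, map_add, map_sub, Finsupp.linearCombination_single, one_smul]
      rw [hi z hz, Rat.smul_def]
      simp
    rw [hc, map_zero] at h1
    exact_mod_cast h1.symm
  -- Thus `S` descends to the range of `F` and extends to the whole space; its values on basis
  -- vectors are the primitive.
  obtain ⟨G, hG⟩ : ∃ G : (Γ →₀ ℚ) →ₗ[ℚ] ℚ, G ∘ₗ F = S := by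
    obtain ⟨G, hG⟩ := LinearMap.exists_extend
      ((LinearMap.ker F).liftQ S hker ∘ₗ F.quotKerEquivRange.symm.toLinearMap)
    refine ⟨G, LinearMap.ext fun c => ?_⟩
    have h1 := LinearMap.congr_fun hG ⟨F c, LinearMap.mem_range_self F c⟩
    have h2 : F.quotKerEquivRange.symm ⟨F c, LinearMap.mem_range_self F c⟩ =
        (LinearMap.ker F).mkQ c := F.quotKerEquivRange_symm_apply_image c _
    simpa [h2] using h1
  refine ⟨fun x => G (Finsupp.single x 1), fun x y => ?_⟩
  have := LinearMap.congr_fun hG (Finsupp.single (x, y) 1)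
  simpa [hF, hS] using this

/-- Over a finitely generated group, a rational primitive of an integral cocycle has bounded
denominators. -/
theorem exists_int_primitive [Group.FG Γ] {σ : Γ → Γ → ℤ} {t : Γ → ℚ}
    (ht : ∀ x y, t x + t y - t (x * y) = σ x y) :
    ∃ D : ℕ, 0 < D ∧ ∃ b : Γ → ℤ, ∀ x y, b x + b y - b (x * y) = D * σ x y := by
  obtain ⟨T, hT⟩ := Group.FG.out (G := Γ)
  set D : ℕ := ∏ g ∈ T, (t g).den with hD
  have hDpos : 0 < D := Finset.prod_pos fun g _ => (t g).den_pos
  have hone : t 1 = σ 1 1 := by simpa using ht 1 1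
  -- Since `σ` is integral, integrality of `D * t` passes from generators to products and inverses.
  have hall : ∀ g : Γ, ∃ k : ℤ, (D : ℚ) * t g = k := by
    intro g
    have hg : g ∈ Subgroup.closure (T : Set Γ) := hT ▸ Subgroup.mem_top g
    induction hg using Subgroup.closure_induction with
    | mem g hg =>
      obtain ⟨e, he⟩ : (t g).den ∣ D := Finset.dvd_prod_of_mem (fun g => (t g).den) hg
      refine ⟨e * (t g).num, ?_⟩
      rw [he]
      push_cast
      rw [mul_comm ((t g).den : ℚ), mul_assoc, mul_comm _ (t g), Rat.mul_den_eq_num]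
    | one => exact ⟨D * σ 1 1, by rw [hone]; push_cast; ring⟩
    | mul x y _ _ hx hy =>
      obtain ⟨k, hk⟩ := hx
      obtain ⟨l, hl⟩ := hy
      refine ⟨k + l - D * σ x y, ?_⟩
      push_cast
      rw [← hk, ← hl, ← ht x y]
      ring
    | inv x _ hx =>
      obtain ⟨k, hk⟩ := hx
      refine ⟨D * σ x x⁻¹ + D * σ 1 1 - k, ?_⟩
      have h1 := ht x x⁻¹
      rw [mul_inv_cancel, hone] at h1
      push_cast
      rw [← hk, ← h1]
      ring
  choose b hb using hall
  refine ⟨D, hDpos, b, fun x y => ?_⟩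
  have h := congrArg (fun q : ℚ => (D : ℚ) * q) (ht x y)
  simp only [mul_add, mul_sub, hb] at h
  exact_mod_cast h

/-- An asymptotic representation which is projective with cocycles `exp (2πi σ / N)`, where `N` is
the dimension, is not perturbable unless `σ` is torsion in cohomology. -/
theorem exists_primitive_of_isOpNormPerturbable [Group.FG Γ] {σ : Γ → Γ → ℤ} {ι : ℕ → Type*}
    [∀ i, Fintype (ι i)] [∀ i, DecidableEq (ι i)]
    (hcard : Tendsto (fun i => Fintype.card (ι i)) atTop atTop)
    {ρ : ∀ i, Γ → Matrix.unitaryGroup (ι i) ℂ}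
    (hmul : ∀ i x y, ρ i x * ρ i y =
      scalarUnitary (ι i) (2 * Real.pi * σ x y / Fintype.card (ι i)) * ρ i (x * y))
    (hρ : IsOpNormPerturbable ρ) :
    ∃ D : ℕ, 0 < D ∧ ∃ b : Γ → ℤ, ∀ x y, b x + b y - b (x * y) = D * σ x y := by
  obtain ⟨π, hπ⟩ := hρ
  have hev : ∀ g : Γ, ∀ᶠ i in atTop, opNorm ((π i g).1 - (ρ i g).1) < 1 := fun g =>
    (hπ g).eventually_lt_const one_pos
  have hcard' : Tendsto (fun i => (Fintype.card (ι i) : ℝ)) atTop atTop :=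
    tendsto_natCast_atTop_atTop.comp hcard
  obtain ⟨t, ht⟩ := exists_rat_primitive (σ := σ)
    (τ := fun i x => phase ((π i x)⁻¹ * ρ i x) / (2 * Real.pi)) (by
    intro x y
    have hsmall : ∀ᶠ i in atTop, |2 * Real.pi * σ x y / Fintype.card (ι i)| < 1 := by
      have := (hcard'.const_div_atTop (2 * Real.pi * σ x y)).abs
      rw [abs_zero] at this
      exact this.eventually_lt_const one_pos
    filter_upwards [hev x, hev y, hev (x * y), hsmall, hcard.eventually_gt_atTop 0]
      with i hx hy hxy hs hpos
    have : Nonempty (ι i) := Fintype.card_pos_iff.1 hpos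
    have h := phase_add_eq (hmul i x y) hs hx hy hxy
    have hpi := Real.pi_pos
    field_simp
    linarith)
  exact exists_int_primitive ht

end Obstruction

/-! ### Frobenius against operator norm, and the asymptotic defect. -/

section Norms

variable {ι : Type*} [Fintype ι]

theorem frobNorm_eq_sqrt_sum (M : Matrix ι ι ℂ) :
    frobNorm M = Real.sqrt (∑ i, ∑ j, ‖M i j‖ ^ 2) := by
  rw [frobNorm, Matrix.trace]
  congr 1
  rw [Finset.sum_comm]
  simp only [Matrix.diag, Matrix.mul_apply, Matrix.conjTranspose_apply, Complex.re_sum]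
  refine Finset.sum_congr rfl fun i _ => Finset.sum_congr rfl fun j _ => ?_
  rw [Complex.star_def, ← Complex.normSq_eq_conj_mul_self, Complex.ofReal_re,
    Complex.normSq_eq_norm_sq]

theorem opNorm_le_frobNorm [DecidableEq ι] (M : Matrix ι ι ℂ) : opNorm M ≤ frobNorm M := by
  rw [opNorm, frobNorm_eq_sqrt_sum]
  refine ContinuousLinearMap.opNorm_le_bound _ (Real.sqrt_nonneg _) fun v => ?_
  rw [EuclideanSpace.norm_eq, EuclideanSpace.norm_eq, ← Real.sqrt_mul (by positivity)]
  refine Real.sqrt_le_sqrt ?_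
  rw [Finset.sum_mul]
  refine Finset.sum_le_sum fun i _ => ?_
  have h1 : ‖(Matrix.toEuclideanCLM (n := ι) (𝕜 := ℂ) M v) i‖ ≤ ∑ j, ‖M i j‖ * ‖v j‖ := by
    rw [Matrix.ofLp_toEuclideanCLM, Matrix.mulVec, dotProduct]
    refine (norm_sum_le _ _).trans_eq ?_
    simp
  calc _ ≤ (∑ j, ‖M i j‖ * ‖v j‖) ^ 2 := by gcongr
    _ ≤ _ := Finset.sum_mul_sq_le_sq_mul_sq _ _ _

theorem frobNorm_smul_unitary [DecidableEq ι] (c : ℂ) (U : Matrix.unitaryGroup ι ℂ) :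
    frobNorm (c • U.1) = ‖c‖ * Real.sqrt (Fintype.card ι) := by
  have hU : U.1.conjTranspose * U.1 = 1 := Unitary.coe_star_mul_self U
  rw [frobNorm, Matrix.conjTranspose_smul, smul_mul_smul_comm, hU, Matrix.trace_smul,
    Matrix.trace_one, Complex.star_def, ← Complex.normSq_eq_conj_mul_self,
    Complex.normSq_eq_norm_sq, smul_eq_mul, Complex.re_ofReal_mul, Complex.natCast_re,
    Real.sqrt_mul (by positivity), Real.sqrt_sq (norm_nonneg c)]

variable {Γ : Type*} [Group Γ] {κ : ℕ → Type*} [∀ i, Fintype (κ i)] [∀ i, DecidableEq (κ i)]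

theorem IsFrobeniusPerturbable.isOpNormPerturbable {ρ : ∀ i, Γ → Matrix.unitaryGroup (κ i) ℂ}
    (hρ : IsFrobeniusPerturbable ρ) : IsOpNormPerturbable ρ := by
  obtain ⟨π, hπ⟩ := hρ
  exact ⟨π, fun x => squeeze_zero (fun i => norm_nonneg _) (fun i => opNorm_le_frobNorm _) (hπ x)⟩

/-- Projective representations with cocycles `exp (2πi σ / N)`, where `N → ∞` is the dimension,
form a Frobenius asymptotic representation. -/
theorem isFrobeniusAsymptoticRep_of_scalar {σ : Γ → Γ → ℤ}
    (hcard : Tendsto (fun i => Fintype.card (κ i)) atTop atTop)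
    {ρ : ∀ i, Γ → Matrix.unitaryGroup (κ i) ℂ}
    (hmul : ∀ i x y, ρ i x * ρ i y =
      scalarUnitary (κ i) (2 * Real.pi * σ x y / Fintype.card (κ i)) * ρ i (x * y)) :
    IsFrobeniusAsymptoticRep ρ := by
  intro x y
  -- The scalar is within `2π|σ|/N` of `1`, and a unitary has Frobenius norm `√N`.
  have hlim : Tendsto (fun i => |2 * Real.pi * σ x y| / Real.sqrt (Fintype.card (κ i)))
      atTop (𝓝 0) :=
    (Real.tendsto_sqrt_atTop.comp (tendsto_natCast_atTop_atTop.comp hcard)).const_div_atTop _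
  refine squeeze_zero (fun i => Real.sqrt_nonneg _) (fun i => ?_) hlim
  set s : ℝ := 2 * Real.pi * σ x y / Fintype.card (κ i) with hs
  have h1 : (ρ i (x * y)).1 - (ρ i x).1 * (ρ i y).1 =
      (1 - Complex.exp (s * Complex.I)) • (ρ i (x * y)).1 := by
    rw [← Submonoid.coe_mul, hmul, Submonoid.coe_mul, coe_scalarUnitary, smul_mul_assoc, one_mul,
      sub_smul, one_smul]
  have h2 : ‖1 - Complex.exp (s * Complex.I)‖ ≤ |s| := by
    have := Real.norm_exp_I_mul_ofReal_sub_one_le (x := s)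
    rwa [mul_comm, Real.norm_eq_abs, norm_sub_rev] at this
  rw [h1, frobNorm_smul_unitary]
  refine (mul_le_mul_of_nonneg_right h2 (Real.sqrt_nonneg _)).trans_eq ?_
  rw [hs, abs_div, Nat.abs_cast, div_mul_eq_mul_div, mul_div_assoc, Real.sqrt_div_self,
    ← div_eq_mul_inv]

end Norms

/-! ### Weighted shifts as projective representations. -/

section Shift

variable {n : ℕ} [NeZero n]

/-- The weighted shift `δ_j ↦ exp (2πi f(j) / n) δ_{j + k}` on `ℓ²(ℤ/n)`. -/
noncomputable def shiftMatrix (k : ZMod n) (f : ZMod n → ZMod n) : Matrix (ZMod n) (ZMod n) ℂ :=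
  Matrix.of fun i j => if i = j + k then ZMod.stdAddChar (f j) else 0

theorem shiftMatrix_apply (k : ZMod n) (f : ZMod n → ZMod n) (i j : ZMod n) :
    shiftMatrix k f i j = if i = j + k then ZMod.stdAddChar (f j) else 0 := rfl

theorem shiftMatrix_mulVec_single (k : ZMod n) (f : ZMod n → ZMod n) (j : ZMod n) :
    (shiftMatrix k f).mulVec (Pi.single j 1) =
      (ZMod.stdAddChar (f j) : ℂ) • Pi.single (j + k) (1 : ℂ) := by
  ext i
  by_cases h : i = j + k <;> simp [shiftMatrix_apply, h]

theorem shiftMatrix_mul (k l : ZMod n) (f g : ZMod n → ZMod n) :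
    shiftMatrix k f * shiftMatrix l g = shiftMatrix (k + l) fun j => g j + f (j + l) := by
  ext i j
  simp only [Matrix.mul_apply, shiftMatrix_apply, mul_ite, mul_zero, Finset.sum_ite_eq',
    Finset.mem_univ, if_true]
  rw [add_assoc, add_comm l k, AddChar.map_add_eq_mul, ite_mul, zero_mul, mul_comm]

theorem shiftMatrix_zero : shiftMatrix (0 : ZMod n) 0 = 1 := by
  ext i j
  simp [shiftMatrix_apply, Matrix.one_apply]

theorem star_shiftMatrix (k : ZMod n) (f : ZMod n → ZMod n) :
    star (shiftMatrix k f) = shiftMatrix (-k) fun j => -f (j - k) := by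
  ext i j
  rw [Matrix.star_apply, shiftMatrix_apply, shiftMatrix_apply, apply_ite star, star_zero]
  by_cases h : j = i + k
  · have h' : i = j + -k := by rw [h]; ring
    have h'' : j - k = i := by rw [h]; ring
    rw [if_pos h, if_pos h', h'', AddChar.map_neg_eq_conj]
    rfl
  · have h' : i ≠ j + -k := by rintro rfl; apply h; ring
    rw [if_neg h, if_neg h']

theorem shiftMatrix_mem_unitaryGroup (k : ZMod n) (f : ZMod n → ZMod n) :
    shiftMatrix k f ∈ Matrix.unitaryGroup (ZMod n) ℂ := by
  rw [Matrix.mem_unitaryGroup_iff', star_shiftMatrix, shiftMatrix_mul, ← shiftMatrix_zero]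
  congr 1
  · ring
  · ext j
    simp

theorem eq_of_mulVec_single {M N : Matrix (ZMod n) (ZMod n) ℂ}
    (h : ∀ j : ℤ, M.mulVec (Pi.single (j : ZMod n) 1) = N.mulVec (Pi.single (j : ZMod n) 1)) :
    M = N := by
  ext i j
  obtain ⟨j, rfl⟩ := ZMod.intCast_surjective j
  simpa using congrFun (h j) i

variable {Γ : Type*} [Group Γ]

/-- If `σ(g, h)` modulo `n` depends only on `g` and on `α h` modulo `n`, then the weighted shifts
with weights `σ(g, ·)` form a projective representation of dimension `n`. -/
theorem mul_eq_scalarUnitary_mul {σ : Γ → Γ → ℤ} {α : Γ →* Multiplicative ℤ} {a : Γ}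
    (ha : α a = Multiplicative.ofAdd 1)
    (hσ : ∀ x y z, σ (x * y) z + σ x y = σ y z + σ x (y * z))
    {ρ : Γ → Matrix.unitaryGroup (ZMod n) ℂ} {f : Γ → ZMod n → ZMod n}
    (hf : ∀ g h, f g ((α h).toAdd : ZMod n) = σ g h)
    (hρ : ∀ g, (ρ g).1 = shiftMatrix ((α g).toAdd : ZMod n) (f g)) (x y : Γ) :
    ρ x * ρ y = scalarUnitary (ZMod n) (2 * Real.pi * σ x y / Fintype.card (ZMod n)) *
      ρ (x * y) := by
  refine Subtype.ext ?_
  have hexp : Complex.exp ((2 * Real.pi * σ x y / Fintype.card (ZMod n) : ℝ) * Complex.I) =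
      ZMod.stdAddChar ((σ x y : ℤ) : ZMod n) := by
    rw [ZMod.stdAddChar_coe, ZMod.card]
    congr 1
    push_cast
    ring
  rw [Submonoid.coe_mul, Submonoid.coe_mul, hρ, hρ, hρ, shiftMatrix_mul, coe_scalarUnitary,
    smul_mul_assoc, one_mul, hexp]
  ext i j
  obtain ⟨j, rfl⟩ := ZMod.intCast_surjective j
  have hz : (α (a ^ j)).toAdd = j := by rw [map_zpow, ha]; simp
  have hyz : (j : ZMod n) + ((α y).toAdd : ZMod n) = ((α (y * a ^ j)).toAdd : ZMod n) := by
    rw [map_mul, toAdd_mul, hz]; push_cast; ring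
  -- This is the cocycle identity for `(x, y, a ^ j)`, with `a ^ j` representing the basis index
  -- `j`.
  have hcoc : f y (j : ZMod n) + f x ((j : ZMod n) + ((α y).toAdd : ZMod n)) =
      (σ x y : ZMod n) + f (x * y) (j : ZMod n) := by
    rw [hyz, hf]
    nth_rewrite 1 [← hz]
    nth_rewrite 3 [← hz]
    rw [hf, hf]
    have := hσ x y (a ^ j)
    rw [add_comm (σ x y : ZMod n)]
    exact_mod_cast congrArg (Int.cast : ℤ → ZMod n) this.symm
  rw [Matrix.smul_apply, shiftMatrix_apply, shiftMatrix_apply, hcoc, AddChar.map_add_eq_mul,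
    map_mul, toAdd_mul, Int.cast_add]
  split_ifs <;> simp

end Shift

/-! ### Cocycles, coboundaries and the central extension by `ℤ`. -/

section Cohomology

open groupCohomology

variable {Γ : Type} [Group Γ]

theorem cocycleVal_identity (σ : cocycles₂ (trivialInt Γ)) (x y z : Γ) :
    cocycleVal σ (x * y) z + cocycleVal σ x y = cocycleVal σ y z + cocycleVal σ x (y * z) :=
  (mem_cocycles₂_iff (A := trivialInt Γ) σ).1 σ.2 x y z

theorem H2π_eq_zero_iff_exists (σ : cocycles₂ (trivialInt Γ)) :
    H2π (trivialInt Γ) σ = 0 ↔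
      ∃ b : Γ → ℤ, ∀ x y, b x + b y - b (x * y) = cocycleVal σ x y := by
  rw [H2π_eq_zero_iff]
  constructor
  · rintro ⟨b, hb⟩
    refine ⟨b, fun x y => ?_⟩
    have h : b y - b (x * y) + b x = cocycleVal σ x y := congrFun hb (x, y)
    rw [← h]
    ring
  · rintro ⟨b, hb⟩
    refine ⟨b, funext fun z => ?_⟩
    have h : b z.2 - b (z.1 * z.2) + b z.1 = cocycleVal σ z.1 z.2 := by
      rw [← hb]
      ring
    exact h

theorem isSkinny_H2π_iff (α : Γ →* Multiplicative ℤ) (σ : cocycles₂ (trivialInt Γ)) :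
    IsSkinny α (H2π (trivialInt Γ) σ) ↔
      ∃ b : α.ker → ℤ, ∀ x y, b x + b y - b (x * y) = cocycleVal σ x y := by
  have h : H2pullback α.ker.subtype (H2π (trivialInt Γ) σ) =
      H2π (trivialInt α.ker) (mapCocycles₂ α.ker.subtype (resTrivialInt α.ker.subtype) σ) :=
    H2π_comp_map_apply α.ker.subtype (resTrivialInt α.ker.subtype) σ
  rw [IsSkinny, h, H2π_eq_zero_iff_exists]
  rfl

theorem isOfFinAddOrder_H2π {σ : cocycles₂ (trivialInt Γ)} {D : ℕ} (hD : 0 < D) {b : Γ → ℤ}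
    (hb : ∀ x y, b x + b y - b (x * y) = D * cocycleVal σ x y) :
    IsOfFinAddOrder (H2π (trivialInt Γ) σ) := by
  rw [isOfFinAddOrder_iff_nsmul_eq_zero]
  refine ⟨D, hD, ?_⟩
  rw [← map_nsmul, H2π_eq_zero_iff_exists]
  refine ⟨b, fun x y => ?_⟩
  rw [hb, ← nsmul_eq_mul]
  rfl

/-- Adding a coboundary to a cocycle. -/
theorem exists_cocycle_add_coboundary (σ : cocycles₂ (trivialInt Γ)) (b : Γ → ℤ) :
    ∃ τ : cocycles₂ (trivialInt Γ), H2π (trivialInt Γ) τ = H2π (trivialInt Γ) σ ∧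
      ∀ x y, cocycleVal τ x y = cocycleVal σ x y + (b x + b y - b (x * y)) := by
  have hb : (fun z : Γ × Γ => b z.2 - b (z.1 * z.2) + b z.1) ∈ cocycles₂ (trivialInt Γ) := by
    refine (mem_cocycles₂_iff (A := trivialInt Γ) _).2 fun x y z => ?_
    change b z - b (x * y * z) + b (x * y) + (b y - b (x * y) + b x) =
      b z - b (y * z) + b y + (b (y * z) - b (x * (y * z)) + b x)
    rw [mul_assoc x y z]
    ring
  refine ⟨σ + ⟨_, hb⟩, ?_, fun x y => ?_⟩
  · rw [map_add, add_eq_left, H2π_eq_zero_iff_exists]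
    refine ⟨b, fun x y => ?_⟩
    change b x + b y - b (x * y) = b y - b (x * y) + b x
    ring
  · change cocycleVal σ x y + (b y - b (x * y) + b x) = _
    ring

/-- The central extension of `Γ` by `ℤ` defined by a cocycle. -/
@[ext]
structure CocycleExt (σ : cocycles₂ (trivialInt Γ)) where
  /-- The central coordinate. -/
  fst : ℤ
  /-- The image in `Γ`. -/
  snd : Γ

namespace CocycleExt

variable {σ : cocycles₂ (trivialInt Γ)}

instance : Mul (CocycleExt σ) :=
  ⟨fun e f => ⟨e.fst + f.fst + cocycleVal σ e.snd f.snd, e.snd * f.snd⟩⟩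

/-- The cocycle need not be normalized, whence the correction by `σ(1, 1)` here and in the inverse
and `incl`. -/
instance : One (CocycleExt σ) := ⟨⟨-cocycleVal σ 1 1, 1⟩⟩

instance : Inv (CocycleExt σ) :=
  ⟨fun e => ⟨-e.fst - cocycleVal σ e.snd⁻¹ e.snd - cocycleVal σ 1 1, e.snd⁻¹⟩⟩

theorem mul_fst (e f : CocycleExt σ) :
    (e * f).fst = e.fst + f.fst + cocycleVal σ e.snd f.snd := rfl

theorem mul_snd (e f : CocycleExt σ) : (e * f).snd = e.snd * f.snd := rfl

theorem cocycleVal_one_left (g : Γ) : cocycleVal σ 1 g = cocycleVal σ 1 1 :=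
  cocycles₂_map_one_fst σ g

theorem cocycleVal_one_right (g : Γ) : cocycleVal σ g 1 = cocycleVal σ 1 1 :=
  cocycles₂_map_one_snd σ g

instance : Group (CocycleExt σ) :=
  Group.ofLeftAxioms
    (fun e f k => by
      ext
      · simp only [mul_fst, mul_snd]
        linarith [cocycleVal_identity σ e.snd f.snd k.snd]
      · exact mul_assoc _ _ _)
    (fun e => by
      ext
      · change -cocycleVal σ 1 1 + e.fst + cocycleVal σ 1 e.snd = e.fst
        rw [cocycleVal_one_left e.snd]
        ring
      · exact one_mul _)
    (fun e => by
      ext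
      · change -e.fst - cocycleVal σ e.snd⁻¹ e.snd - cocycleVal σ 1 1 + e.fst +
          cocycleVal σ e.snd⁻¹ e.snd = -cocycleVal σ 1 1
        ring
      · exact inv_mul_cancel _)

/-- The projection of the extension onto `Γ`. -/
def proj : CocycleExt σ →* Γ where
  toFun := snd
  map_one' := rfl
  map_mul' _ _ := rfl

/-- The central subgroup `ℤ` of the extension. -/
def incl : Multiplicative ℤ →* CocycleExt σ where
  toFun k := ⟨k.toAdd - cocycleVal σ 1 1, 1⟩
  map_one' := by
    ext
    · change 0 - cocycleVal σ 1 1 = -cocycleVal σ 1 1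
      ring
    · rfl
  map_mul' k l := by
    ext
    · rw [mul_fst, toAdd_mul]
      ring
    · exact (mul_one 1).symm

theorem incl_mul (k : Multiplicative ℤ) (e : CocycleExt σ) :
    incl k * e = ⟨k.toAdd + e.fst, e.snd⟩ := by
  ext
  · change k.toAdd - cocycleVal σ 1 1 + e.fst + cocycleVal σ 1 e.snd = _
    rw [cocycleVal_one_left e.snd]
    ring
  · exact one_mul _

theorem mul_incl (k : Multiplicative ℤ) (e : CocycleExt σ) : e * incl k = incl k * e := by
  rw [incl_mul]
  ext
  · change e.fst + (k.toAdd - cocycleVal σ 1 1) + cocycleVal σ e.snd 1 = _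
    rw [cocycleVal_one_right e.snd]
    ring
  · exact mul_one _

end CocycleExt

end Cohomology

/-! ### Newton expansion of iterated conjugation. -/

section Differences

variable {G : Type*} [Group G]

/-- The iterated differences `(ψ* - 1)ⁱ h` of a homomorphism `h` under an automorphism `ψ`. -/
def iterDiff (ψ : MulAut G) (h : G →* Multiplicative ℤ) : ℕ → (G →* Multiplicative ℤ)
  | 0 => h
  | i + 1 => (iterDiff ψ h i).comp ψ.toMonoidHom / iterDiff ψ h i

theorem toAdd_iterDiff_apply (ψ : MulAut G) (h : G →* Multiplicative ℤ) (i : ℕ) (x : G) :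
    (iterDiff ψ h i (ψ x)).toAdd = (iterDiff ψ h i x).toAdd + (iterDiff ψ h (i + 1) x).toAdd := by
  have : (iterDiff ψ h (i + 1) x).toAdd =
    (iterDiff ψ h i (ψ x)).toAdd - (iterDiff ψ h i x).toAdd := rfl
  rw [this]
  ring

/-- The Newton expansion `∑ᵢ (l choose i+1) (ψ* - 1)ⁱ h` of `h + ψ* h + ⋯ + ψ*ˡ⁻¹ h`. -/
def newtonSum (ψ : MulAut G) (h : G →* Multiplicative ℤ) (N : ℕ) (l : ℤ) (x : G) : ℤ :=
  ∑ i ∈ Finset.range N, Ring.choose l (i + 1) * (iterDiff ψ h i x).toAdd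

theorem newtonSum_zero (ψ : MulAut G) (h : G →* Multiplicative ℤ) (N : ℕ) (x : G) :
    newtonSum ψ h N 0 x = 0 :=
  Finset.sum_eq_zero fun i _ => by rw [Ring.choose_zero_succ, zero_mul]

/-- Pascal's rule for `Ring.choose`, valid for negative `l` as well, is combined with `ψ* = 1 + (ψ*
- 1)`; `hN` removes the top term. -/
theorem newtonSum_add_one {ψ : MulAut G} {h : G →* Multiplicative ℤ} {N : ℕ}
    (hN : iterDiff ψ h N = 1) (l : ℤ) (x : G) :
    newtonSum ψ h N (l + 1) x = (h x).toAdd + newtonSum ψ h N l (ψ x) := by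
  have h1 : ∀ i, Ring.choose (l + 1) (i + 1) = Ring.choose l i + Ring.choose l (i + 1) := fun i =>
    Ring.choose_succ_succ l i
  have h2 : (∑ i ∈ Finset.range N, Ring.choose l i * (iterDiff ψ h i x).toAdd) =
      (h x).toAdd + ∑ i ∈ Finset.range N, Ring.choose l (i + 1) * (iterDiff ψ h (i + 1) x).toAdd := by
    have h3 := Finset.sum_range_succ (fun i => Ring.choose l i * (iterDiff ψ h i x).toAdd) N
    rw [Finset.sum_range_succ', hN, Ring.choose_zero_right, one_mul] at h3
    simp only [MonoidHom.one_apply, toAdd_one, mul_zero, add_zero] at h3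
    rw [← h3, add_comm]
    rfl
  simp only [newtonSum, h1, toAdd_iterDiff_apply, add_mul, mul_add, Finset.sum_add_distrib]
  rw [h2]
  ring

variable {E : Type*} [Group E]

/-- If `t⁻¹ s(x) t = z(h x) s(ψ x)`, then `t⁻ˡ s(x) tˡ = z(F) s(ψˡ x)` with the Newton sum `F`. -/
theorem zpow_conj_eq_newtonSum {s : G →* E} {z : Multiplicative ℤ →* E}
    (hz : ∀ k e, e * z k = z k * e) {t : E} {ψ : MulAut G} {h : G →* Multiplicative ℤ}
    (hconj : ∀ x, t⁻¹ * s x * t = z (h x) * s (ψ x)) {N : ℕ} (hN : iterDiff ψ h N = 1)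
    (l : ℤ) (x : G) :
    t ^ (-l) * s x * t ^ l = z (Multiplicative.ofAdd (newtonSum ψ h N l x)) * s ((ψ ^ l) x) := by
  have hstep : ∀ (k : ℤ) (x : G), t ^ (-(k + 1)) * s x * t ^ (k + 1) =
      z (h x) * (t ^ (-k) * s (ψ x) * t ^ k) := by
    intro k x
    calc t ^ (-(k + 1)) * s x * t ^ (k + 1) = t ^ (-k) * (t⁻¹ * s x * t) * t ^ k := by group
      _ = t ^ (-k) * z (h x) * s (ψ x) * t ^ k := by rw [hconj, ← mul_assoc (t ^ (-k))]
      _ = _ := by rw [hz]; group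
  have hstep' : ∀ (k : ℤ) (x : G),
      z (Multiplicative.ofAdd (newtonSum ψ h N (k + 1) x)) * s ((ψ ^ (k + 1)) x) =
      z (h x) * (z (Multiplicative.ofAdd (newtonSum ψ h N k (ψ x))) * s ((ψ ^ k) (ψ x))) := by
    intro k x
    rw [newtonSum_add_one hN, ofAdd_add, ofAdd_toAdd, map_mul, mul_assoc, zpow_add_one]
    rfl
  induction l using Int.induction_on generalizing x with
  | zero => simp [newtonSum_zero]
  | succ k ih => rw [hstep, hstep', ih]
  -- The recursion is run backwards: `ψ` is surjective and the central factor `z (h y)` cancels.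
  | pred k ih =>
    obtain ⟨y, rfl⟩ := ψ.surjective x
    have h1 := ih y
    rw [show (-(k : ℤ)) = (-k - 1) + 1 by ring, hstep, hstep'] at h1
    exact mul_left_cancel h1

end Differences

/-! ### Nilpotency of the difference operator. -/

section Nilpotent

variable {Γ : Type*} [Group Γ]

/-- Iterated differences under conjugation in a nilpotent group eventually vanish. -/
theorem exists_iterDiff_eq_one [Group.IsNilpotent Γ] (Λ : Subgroup Γ) [Λ.Normal] (a : Γ)
    (h : Λ →* Multiplicative ℤ) :
    ∃ N, iterDiff (MulAut.conjNormal a⁻¹ : MulAut Λ) h N = 1 := by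
  obtain ⟨M, H, ⟨hH0, hH⟩, hHM⟩ :=
    (Subgroup.nilpotent_iff_finite_descending_central_series Γ).1 inferInstance
  -- One more difference at `x` evaluates the previous one at `a⁻¹ x a x⁻¹`, which lies one step
  -- deeper in the central series.
  have key : ∀ i ≤ M, ∀ x : Λ, (x : Γ) ∈ H (M - i) →
      iterDiff (MulAut.conjNormal a⁻¹ : MulAut Λ) h i x = 1 := by
    intro i
    induction i with
    | zero =>
      intro _ x hx
      rw [Nat.sub_zero, hHM, Subgroup.mem_bot] at hx
      rw [show x = 1 from Subtype.ext hx, map_one]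
    | succ i ih =>
      intro hi x hx
      have h1 : iterDiff (MulAut.conjNormal a⁻¹ : MulAut Λ) h (i + 1) x =
          iterDiff (MulAut.conjNormal a⁻¹ : MulAut Λ) h i (MulAut.conjNormal a⁻¹ x * x⁻¹) := by
        rw [map_mul, map_inv (iterDiff _ h i), ← div_eq_mul_inv]
        rfl
      rw [h1]
      refine ih (by omega) _ ?_
      have h2 := (H (M - (i + 1) + 1)).inv_mem (hH x _ hx a⁻¹)
      rw [show M - (i + 1) + 1 = M - i by omega] at h2
      convert h2 using 1
      push_cast
      rw [MulAut.conjNormal_apply, commutatorElement_def]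
      group
  refine ⟨M, MonoidHom.ext fun x => key M le_rfl x ?_⟩
  rw [Nat.sub_self, hH0]
  exact Subgroup.mem_top _

end Nilpotent

/-! ### The Newton representative of a skinny class. -/

section NewtonCocycle

open groupCohomology

variable {Γ : Type} [Group Γ]

namespace CocycleExt

variable {σ : cocycles₂ (trivialInt Γ)}

theorem incl_mul_right_injective {k l : Multiplicative ℤ} {e : CocycleExt σ}
    (h : incl k * e = incl l * e) : k = l := by
  rw [incl_mul, incl_mul] at h
  have h1 := congrArg fst h
  exact Multiplicative.toAdd.injective (add_right_cancel h1)

theorem exists_eq_incl_mul {e f : CocycleExt σ} (h : e.snd = f.snd) :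
    ∃ k, e = incl k * f := by
  refine ⟨Multiplicative.ofAdd (e.fst - f.fst), ?_⟩
  rw [incl_mul]
  ext
  · simp
  · exact h

end CocycleExt

/-- A class that is skinny with respect to a split homomorphism `α` has a cocycle representative
which is a homomorphism in the first variable on `ker α` and a Newton polynomial in `α` of the
second variable. -/
theorem exists_newton_cocycle [Group.IsNilpotent Γ] {α : Γ →* Multiplicative ℤ} {a : Γ}
    (ha : α a = Multiplicative.ofAdd 1) {c : H2 (trivialInt Γ)} (hc : IsSkinny α c) :
    ∃ σ : cocycles₂ (trivialInt Γ), H2π (trivialInt Γ) σ = c ∧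
      ∃ (N : ℕ) (h : ℕ → (α.ker →* Multiplicative ℤ)), ∀ (k l : ℤ) (x y : α.ker),
        cocycleVal σ (a ^ k * x) (a ^ l * y) =
          ∑ i ∈ Finset.range N, Ring.choose l (i + 1) * (h i x).toAdd := by
  induction c using H2_induction_on with | h σ₀ => ?_
  obtain ⟨b₀, hb₀⟩ := (isSkinny_H2π_iff α σ₀).1 hc
  -- A primitive of the cocycle on `ker α` is the same as a splitting of the extension there.
  let s : α.ker →* CocycleExt σ₀ := MonoidHom.mk' (fun x => ⟨-b₀ x, x⟩) fun x y => by
    ext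
    · change -b₀ (x * y) = -b₀ x + -b₀ y + cocycleVal σ₀ x y
      rw [← hb₀]
      ring
    · rfl
  let t : CocycleExt σ₀ := ⟨0, a⟩
  let ψ : MulAut α.ker := MulAut.conjNormal a⁻¹
  have hex : ∀ x, ∃ k, t⁻¹ * s x * t = CocycleExt.incl k * s (ψ x) := by
    intro x
    refine CocycleExt.exists_eq_incl_mul ?_
    change a⁻¹ * x * a = (ψ x : Γ)
    rw [MulAut.conjNormal_apply, inv_inv]
  choose h₀ hh₀ using hex
  let h : α.ker →* Multiplicative ℤ := MonoidHom.mk' h₀ fun x y => by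
    refine CocycleExt.incl_mul_right_injective (e := s (ψ (x * y))) ?_
    calc CocycleExt.incl (h₀ (x * y)) * s (ψ (x * y)) = (t⁻¹ * s x * t) * (t⁻¹ * s y * t) := by
          rw [← hh₀, map_mul]; group
      _ = CocycleExt.incl (h₀ x) * (s (ψ x) * CocycleExt.incl (h₀ y)) * s (ψ y) := by
          rw [hh₀, hh₀]; group
      _ = _ := by rw [CocycleExt.mul_incl, map_mul, map_mul, map_mul]; group
  obtain ⟨N, hN⟩ := exists_iterDiff_eq_one α.ker a h
  have hconj := zpow_conj_eq_newtonSum (s := s) CocycleExt.mul_incl (ψ := ψ) (h := h) hh₀ hN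
  have hlam : ∀ g, a ^ (-(α g).toAdd) * g ∈ α.ker := by
    intro g
    rw [MonoidHom.mem_ker, map_mul, map_zpow, ha]
    apply Multiplicative.toAdd.injective
    simp
  let T : Γ → CocycleExt σ₀ := fun g => t ^ (α g).toAdd * s ⟨_, hlam g⟩
  have hαk : ∀ (k : ℤ) (x : α.ker), (α (a ^ k * x)).toAdd = k := by
    intro k x
    rw [map_mul, map_zpow, ha, (MonoidHom.mem_ker).1 x.2]
    simp
  have hT : ∀ (k : ℤ) (x : α.ker), T (a ^ k * x) = t ^ k * s x := by
    intro k x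
    have h1 : (⟨_, hlam (a ^ k * x)⟩ : α.ker) = x := by
      ext
      simp only [hαk]
      group
    change t ^ (α (a ^ k * x)).toAdd * s ⟨_, hlam (a ^ k * x)⟩ = _
    rw [h1, hαk]
  have hTsnd : ∀ g, (T g).snd = g := by
    intro g
    have h1 : (T g).snd = CocycleExt.proj (t ^ (α g).toAdd) * (a ^ (-(α g).toAdd) * g) := rfl
    have h2 : CocycleExt.proj t = a := rfl
    rw [h1, map_zpow, h2]
    group
  -- The cocycle `τ` is the one read off from the section `T`, so only products of values of `T`
  -- need computing.
  obtain ⟨τ, hτ, hτval⟩ := exists_cocycle_add_coboundary σ₀ fun g => (T g).fst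
  refine ⟨τ, hτ, N, iterDiff ψ h, fun k l x y => ?_⟩
  have hmul : a ^ k * x * (a ^ l * y) = a ^ (k + l) * (((ψ ^ l) x * y : α.ker) : Γ) := by
    have h1 : ((ψ ^ l) x : Γ) = a ^ (-l) * x * a ^ l := by
      change (((MulAut.conjNormal a⁻¹ : MulAut α.ker) ^ l) x : Γ) = _
      rw [← map_zpow, MulAut.conjNormal_apply]
      group
    rw [Subgroup.coe_mul, h1]
    group
  have hTT : T (a ^ k * x) * T (a ^ l * y) =
      CocycleExt.incl (Multiplicative.ofAdd (newtonSum ψ h N l x)) *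
        T (a ^ k * x * (a ^ l * y)) := by
    calc T (a ^ k * x) * T (a ^ l * y) = t ^ (k + l) * (t ^ (-l) * s x * t ^ l) * s y := by
          rw [hT, hT]; group
      _ = _ := by
          rw [hconj, hmul, hT, map_mul, ← mul_assoc (t ^ (k + l)), CocycleExt.mul_incl]
          group
  have hfst := congrArg CocycleExt.fst hTT
  rw [CocycleExt.incl_mul, CocycleExt.mul_fst, hTsnd, hTsnd] at hfst
  simp only [toAdd_ofAdd] at hfst
  rw [hτval]
  change _ = newtonSum ψ h N l x
  linarith

end NewtonCocycle

/-! ### Reduction of binomial coefficients and of homomorphisms to `ℤ`. -/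

section Weights

variable {Γ : Type*} [Group Γ]

/-- The function `j ↦ σ(g, aʲ)` modulo `n`. -/
def cocycleWeight (σ : Γ → Γ → ℤ) (a : Γ) (n : ℕ) (g : Γ) (j : ZMod n) : ZMod n :=
  (σ g (a ^ j.val) : ℤ)

theorem cocycleWeight_eq {σ : Γ → Γ → ℤ} {α : Γ →* Multiplicative ℤ} {a : Γ}
    (ha : α a = Multiplicative.ofAdd 1) {n : ℕ} [NeZero n]
    (hdep : ∀ g h h', ((α h).toAdd : ZMod n) = (α h').toAdd → (σ g h : ZMod n) = σ g h')
    (g h : Γ) : cocycleWeight σ a n g ((α h).toAdd : ZMod n) = σ g h := by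
  refine hdep _ _ _ ?_
  rw [map_pow, ha, toAdd_pow, toAdd_ofAdd, nsmul_eq_mul, mul_one, Int.cast_natCast,
    ZMod.natCast_zmod_val]

/-- Multiplying by `k!`, a unit modulo `n`, turns the binomial coefficient into an integral
polynomial in `l`. -/
theorem intCast_choose_eq {n k : ℕ} (hn : Nat.Coprime n k.factorial) {l l' : ℤ}
    (h : (l : ZMod n) = l') : ((Ring.choose l k : ℤ) : ZMod n) = (Ring.choose l' k : ℤ) := by
  have hunit : IsUnit ((k.factorial : ℕ) : ZMod n) := (ZMod.isUnit_iff_coprime _ _).2 hn.symm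
  have key : ∀ r : ℤ, ((k.factorial : ℕ) : ZMod n) * ((Ring.choose r k : ℤ) : ZMod n) =
      (descPochhammer (ZMod n) k).eval (r : ZMod n) := by
    intro r
    have h1 := Ring.descPochhammer_eq_factorial_smul_choose r k
    rw [← descPochhammer_map (Int.castRingHom (ZMod n)), Polynomial.eval_intCast_map, Int.cast_id,
      Polynomial.eval_eq_smeval, h1]
    simp
  apply hunit.mul_left_cancel
  rw [key, key, h]

theorem ratCast_choose_eq (l : ℤ) (k : ℕ) :
    ((Ring.choose l k : ℤ) : ℚ) = (k.factorial : ℚ)⁻¹ * (descPochhammer ℚ k).eval (l : ℚ) := by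
  have h1 := Ring.descPochhammer_eq_factorial_smul_choose l k
  rw [← descPochhammer_map (Int.castRingHom ℚ), Polynomial.eval_intCast_map, Int.cast_id,
    Polynomial.eval_eq_smeval, h1]
  have : (k.factorial : ℚ) ≠ 0 := by exact_mod_cast k.factorial_ne_zero
  simp [this]

theorem exists_eq_zpow_mul {α : Γ →* Multiplicative ℤ} {a : Γ}
    (ha : α a = Multiplicative.ofAdd 1) (g : Γ) :
    ∃ x : α.ker, g = a ^ (α g).toAdd * x := by
  refine ⟨⟨a ^ (-(α g).toAdd) * g, ?_⟩, ?_⟩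
  · rw [MonoidHom.mem_ker, map_mul, map_zpow, ha]
    apply Multiplicative.toAdd.injective
    simp
  · group

/-- A nontrivial homomorphism to `ℤ` has the same kernel as a surjective one. -/
theorem exists_surjective_of_ne_one {α : Γ →* Multiplicative ℤ} (hα : α ≠ 1) :
    ∃ (β : Γ →* Multiplicative ℤ) (a : Γ), β a = Multiplicative.ofAdd 1 ∧ β.ker = α.ker := by
  obtain ⟨d, hd⟩ := Int.subgroup_cyclic (MonoidHom.toAdditiveLeft α).range
  rw [← AddSubgroup.zmultiples_eq_closure] at hd
  have hdvd : ∀ g, d ∣ (α g).toAdd := by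
    intro g
    have h1 : (α g).toAdd ∈ AddSubgroup.zmultiples d := by
      rw [← hd]
      exact ⟨Additive.ofMul g, rfl⟩
    exact Int.mem_zmultiples_iff.1 h1
  have hd0 : d ≠ 0 := by
    rintro rfl
    refine hα (MonoidHom.ext fun g => Multiplicative.toAdd.injective ?_)
    exact zero_dvd_iff.1 (hdvd g)
  obtain ⟨a, ha⟩ : d ∈ (MonoidHom.toAdditiveLeft α).range := by
    rw [hd]
    exact AddSubgroup.mem_zmultiples d
  have ha' : (α a.toMul).toAdd = d := ha
  refine ⟨MonoidHom.mk' (fun g => Multiplicative.ofAdd ((α g).toAdd / d)) fun x y => ?_,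
    a.toMul, ?_, ?_⟩
  · rw [map_mul, toAdd_mul, Int.add_ediv_of_dvd_left (hdvd x), ofAdd_add]
  · change Multiplicative.ofAdd ((α a.toMul).toAdd / d) = _
    rw [ha', Int.ediv_self hd0]
  · ext g
    rw [MonoidHom.mem_ker, MonoidHom.mem_ker]
    change (α g).toAdd / d = 0 ↔ (α g).toAdd = 0
    refine ⟨fun h => ?_, fun h => by rw [h, Int.zero_ediv]⟩
    rw [← Int.ediv_mul_cancel (hdvd g), h, zero_mul]

end Weights

/-! ### Failure of Frobenius stability. -/

section NotStable

open groupCohomology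

variable {Γ : Type} [Group Γ]

theorem IsSkinny.of_ker_eq {α β : Γ →* Multiplicative ℤ} (h : β.ker = α.ker)
    {c : H2 (trivialInt Γ)} (hc : IsSkinny α c) : IsSkinny β c := by
  induction c using H2_induction_on with | h σ => ?_
  obtain ⟨b, hb⟩ := (isSkinny_H2π_iff α σ).1 hc
  exact (isSkinny_H2π_iff β σ).2 ⟨fun x => b (Subgroup.inclusion h.le x), fun x y =>
    hb (Subgroup.inclusion h.le x) (Subgroup.inclusion h.le y)⟩

theorem IsSkinny.eq_zero {c : H2 (trivialInt Γ)} (hc : IsSkinny 1 c) : c = 0 := by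
  induction c using H2_induction_on with | h σ => ?_
  obtain ⟨b, hb⟩ := (isSkinny_H2π_iff 1 σ).1 hc
  exact (H2π_eq_zero_iff_exists σ).2 ⟨fun x => b ⟨x, rfl⟩, fun x y => hb ⟨x, rfl⟩ ⟨y, rfl⟩⟩

/-- Projective representations of dimension tending to infinity whose cocycle represents a
non-torsion class cannot be perturbed to representations. -/
theorem not_isOpNormPerturbable [Group.FG Γ] {σ : cocycles₂ (trivialInt Γ)}
    (hσ : ¬ IsOfFinAddOrder (H2π (trivialInt Γ) σ)) {ι : ℕ → Type*}
    [∀ i, Fintype (ι i)] [∀ i, DecidableEq (ι i)]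
    (hcard : Tendsto (fun i => Fintype.card (ι i)) atTop atTop)
    {ρ : ∀ i, Γ → Matrix.unitaryGroup (ι i) ℂ}
    (hmul : ∀ i x y, ρ i x * ρ i y =
      scalarUnitary (ι i) (2 * Real.pi * cocycleVal σ x y / Fintype.card (ι i)) * ρ i (x * y)) :
    ¬ IsOpNormPerturbable ρ := by
  intro hρ
  obtain ⟨D, hD, b, hb⟩ := exists_primitive_of_isOpNormPerturbable hcard hmul hρ
  exact hσ (isOfFinAddOrder_H2π hD hb)

theorem not_frobeniusStable_of_isSkinny [Group.FG Γ] [Group.IsNilpotent Γ]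
    {α : Γ →* Multiplicative ℤ} {c : H2 (trivialInt Γ)} (hc : IsSkinny α c)
    (hct : ¬ IsOfFinAddOrder c) : ¬ FrobeniusStable Γ := by
  intro hstable
  have hα : α ≠ 1 := by
    rintro rfl
    rw [hc.eq_zero] at hct
    exact hct IsOfFinAddOrder.zero
  obtain ⟨β, a, ha, hker⟩ := exists_surjective_of_ne_one hα
  obtain ⟨σ, rfl, N, h, hσ⟩ := exists_newton_cocycle ha (hc.of_ker_eq hker)
  -- These moduli are coprime to every factorial in the Newton sum. Being syntactic successors, they
  -- also make `ZMod (n i)` unfold to `Fin (n i)`, as `FrobeniusStable` requires.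
  let n : ℕ → ℕ := fun i => i * N.factorial + 1
  have hdep : ∀ i g x y, ((β x).toAdd : ZMod (n i)) = (β y).toAdd →
      (cocycleVal σ g x : ZMod (n i)) = cocycleVal σ g y := by
    intro i g x y hxy
    obtain ⟨g', hg⟩ := exists_eq_zpow_mul ha g
    obtain ⟨x', hx⟩ := exists_eq_zpow_mul ha x
    obtain ⟨y', hy⟩ := exists_eq_zpow_mul ha y
    rw [hg, hx, hy, hσ, hσ]
    push_cast
    refine Finset.sum_congr rfl fun k hk => ?_
    have hcop : Nat.Coprime (n i) (k + 1).factorial := by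
      refine Nat.Coprime.coprime_dvd_right
        (Nat.factorial_dvd_factorial (Finset.mem_range.1 hk)) ?_
      simp [n]
    rw [intCast_choose_eq hcop hxy]
  let ρ : ∀ i, Γ → Matrix.unitaryGroup (ZMod (n i)) ℂ := fun i g =>
    ⟨shiftMatrix ((β g).toAdd : ZMod (n i)) (cocycleWeight (cocycleVal σ) a (n i) g),
      shiftMatrix_mem_unitaryGroup _ _⟩
  have hmul : ∀ i x y, ρ i x * ρ i y = scalarUnitary (ZMod (n i))
      (2 * Real.pi * cocycleVal σ x y / Fintype.card (ZMod (n i))) * ρ i (x * y) := fun i =>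
    mul_eq_scalarUnitary_mul ha (cocycleVal_identity σ) (cocycleWeight_eq ha (hdep i))
      fun _ => rfl
  have hcard : Tendsto (fun i => Fintype.card (ZMod (n i))) atTop atTop := by
    simp only [ZMod.card]
    refine tendsto_atTop_mono (fun i => ?_) tendsto_id
    exact (Nat.le_mul_of_pos_right i N.factorial_pos).trans (Nat.le_succ _)
  have hpert : IsFrobeniusPerturbable ρ :=
    hstable n ρ (isFrobeniusAsymptoticRep_of_scalar hcard hmul)
  exact not_isOpNormPerturbable hct hcard hmul hpert.isOpNormPerturbable

end NotStable

/-! ### Canonical forms split along the canonical homomorphism. -/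

section MalcevCoordinates

variable {Γ : Type*} [Group Γ] {m : ℕ}

theorem prod_ofFn_mulSingle (k : Fin m) (g : Γ) :
    (List.ofFn (Pi.mulSingle k g : Fin m → Γ)).prod = g := by
  induction m with
  | zero => exact k.elim0
  | succ m ih =>
    rw [List.ofFn_succ, List.prod_cons]
    induction k using Fin.cases with
    | zero =>
      have h : (fun i : Fin m => (Pi.mulSingle 0 g : Fin (m + 1) → Γ) i.succ) = fun _ => 1 :=
        funext fun i => Pi.mulSingle_eq_of_ne (Fin.succ_ne_zero i) g
      rw [h, Pi.mulSingle_eq_same]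
      simp
    | succ k =>
      have h : (fun i : Fin m => (Pi.mulSingle k.succ g : Fin (m + 1) → Γ) i.succ) =
          Pi.mulSingle k g := by
        ext i
        simp [Pi.mulSingle_apply]
      rw [h, ih, Pi.mulSingle_eq_of_ne (Fin.succ_ne_zero k).symm, one_mul]

theorem canonicalForm_single (a : Fin m → Γ) (k : Fin m) :
    canonicalForm a (Pi.single k 1) = a k := by
  have h : (fun i => a i ^ (Pi.single k 1 : Fin m → ℤ) i) = Pi.mulSingle k (a k) := by
    ext i
    by_cases hi : i = k
    · subst hi; simp
    · simp [hi]
  rw [canonicalForm, h, prod_ofFn_mulSingle]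

variable {a : Fin (m + 1) → Γ} {α : Γ →* Multiplicative ℤ}

theorem IsCanonicalHom.apply_zero (hα : IsCanonicalHom a α) :
    α (a 0) = Multiplicative.ofAdd 1 := by
  rw [← canonicalForm_single a 0, hα, Pi.single_eq_same]

theorem IsCanonicalHom.apply_succ_mem_ker (hα : IsCanonicalHom a α) (k : Fin m) :
    a k.succ ∈ α.ker := by
  rw [MonoidHom.mem_ker, ← canonicalForm_single a k.succ, hα,
    Pi.single_eq_of_ne (Fin.succ_ne_zero k).symm, ofAdd_zero]

theorem IsCanonicalHom.canonicalForm_eq (hα : IsCanonicalHom a α) (x : Fin (m + 1) → ℤ) :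
    canonicalForm a x = a 0 ^ x 0 * (canonicalForm
      (fun k : Fin m => (⟨a k.succ, hα.apply_succ_mem_ker k⟩ : α.ker))
      (fun k => x k.succ) : α.ker) := by
  rw [canonicalForm, canonicalForm, List.ofFn_succ, List.prod_cons, Subgroup.val_list_prod,
    List.map_ofFn]
  rfl

theorem toAdd_map_canonicalForm {G : Type*} [Group G] (b : Fin m → G) (x : Fin m → ℤ)
    (h : G →* Multiplicative ℤ) :
    (h (canonicalForm b x)).toAdd = ∑ k, x k * (h (b k)).toAdd := by
  rw [canonicalForm, map_list_prod, List.map_ofFn, List.prod_ofFn, toAdd_prod]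
  simp

end MalcevCoordinates

/-! ### Polynomial cocycles in Mal'cev coordinates and the maps `ρ_n`. -/

section Polynomial

open groupCohomology MvPolynomial

variable {Γ : Type} [Group Γ] {m : ℕ} {a : Fin (m + 1) → Γ} {α : Γ →* Multiplicative ℤ}

/-- A skinny class has a normalized polynomial representative. -/
theorem exists_polynomial_cocycle [Group.IsNilpotent Γ] (hα : IsCanonicalHom a α)
    {c : H2 (trivialInt Γ)} (hc : IsSkinny α c) :
    ∃ (σ : cocycles₂ (trivialInt Γ)) (p : MvPolynomial (Option (Fin (m + 1))) ℚ),
      H2π (trivialInt Γ) σ = c ∧ IsNormalized σ ∧ IsGivenBy a σ p := by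
  obtain ⟨σ, hσc, N, h, hσ⟩ := exists_newton_cocycle hα.apply_zero hc
  -- The binomial coefficient is a falling factorial over `(i + 1)!`, and each `h i` is linear in
  -- the coordinates on `ker α`.
  refine ⟨σ, ∑ i ∈ Finset.range N, C (((i + 1).factorial : ℚ)⁻¹) *
    Polynomial.aeval (X none) (descPochhammer ℚ (i + 1)) *
      ∑ k : Fin m, X (some k.succ) *
        C ((h i ⟨a k.succ, hα.apply_succ_mem_ker k⟩).toAdd : ℚ), hσc, fun g => ⟨?_, ?_⟩, ?_⟩
  · obtain ⟨x, hx⟩ := exists_eq_zpow_mul hα.apply_zero g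
    have h1 := hσ (α g).toAdd 0 x 1
    rw [← hx, zpow_zero, Subgroup.coe_one, mul_one] at h1
    rw [h1]
    exact Finset.sum_eq_zero fun i _ => by rw [Ring.choose_zero_succ, zero_mul]
  · obtain ⟨x, hx⟩ := exists_eq_zpow_mul hα.apply_zero g
    have h1 := hσ 0 (α g).toAdd 1 x
    rw [← hx, zpow_zero, Subgroup.coe_one, mul_one] at h1
    rw [h1]
    exact Finset.sum_eq_zero fun i _ => by rw [map_one, toAdd_one, mul_zero]
  · intro x y
    rw [hα.canonicalForm_eq x, hα.canonicalForm_eq y, hσ, polyVal, map_sum, Int.cast_sum]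
    refine Finset.sum_congr rfl fun i _ => ?_
    have h1 : eval (fun o : Option (Fin (m + 1)) => o.elim ((y 0 : ℤ) : ℚ) fun i => (x i : ℚ))
        (Polynomial.aeval (X none : MvPolynomial (Option (Fin (m + 1))) ℚ)
          (descPochhammer ℚ (i + 1))) = (descPochhammer ℚ (i + 1)).eval ((y 0 : ℤ) : ℚ) := by
      rw [← MvPolynomial.coe_aeval_eq_eval, RingHom.coe_coe, ← Polynomial.aeval_algHom_apply,
        aeval_X, Polynomial.coe_aeval_eq_eval]
      rfl
    rw [toAdd_map_canonicalForm, map_mul, map_mul, h1, eval_C, ← ratCast_choose_eq]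
    simp

/-- A cocycle given by a polynomial is determined modulo `n` by its first argument and by the
canonical homomorphism modulo `n` of its second one, if `n` is coprime to the denominators. -/
theorem IsGivenBy.intCast_eq {σ : cocycles₂ (trivialInt Γ)}
    {p : MvPolynomial (Option (Fin (m + 1))) ℚ} (hp : IsGivenBy a σ p) (ha : IsMalcevBasis a)
    (hα : IsCanonicalHom a α) {n : ℕ} (hn : CoprimeToDenominators p n) (g h h' : Γ)
    (hh : ((α h).toAdd : ZMod n) = (α h').toAdd) :
    (cocycleVal σ g h : ZMod n) = cocycleVal σ g h' := by
  obtain ⟨x, rfl, -⟩ := ha.existsUnique_form g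
  -- `D * p` has integer coefficients, so its values can be reduced modulo `n`, and `D` is
  -- invertible there.
  set D : ℕ := ∏ s ∈ p.support, (p.coeff s).den with hD
  have hDn : Nat.Coprime D n := Nat.Coprime.prod_left fun s _ => (hn s).symm
  have hunit : IsUnit (D : ZMod n) := (ZMod.isUnit_iff_coprime _ _).2 hDn
  have hintegral : ∀ s, ∃ k : ℤ, s ∈ p.support → (D : ℚ) * p.coeff s = k := by
    intro s
    by_cases hs : s ∈ p.support
    · obtain ⟨e, he⟩ : (p.coeff s).den ∣ D :=
        Finset.dvd_prod_of_mem (fun s => (p.coeff s).den) hs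
      refine ⟨e * (p.coeff s).num, fun _ => ?_⟩
      rw [he]
      push_cast
      rw [mul_comm ((p.coeff s).den : ℚ), mul_assoc, mul_comm _ (p.coeff s), Rat.mul_den_eq_num]
    · exact ⟨0, fun h => absurd h hs⟩
  choose κ hκ using hintegral
  have key : ∀ h : Γ, (D : ZMod n) * (cocycleVal σ (canonicalForm a x) h : ZMod n) =
      ∑ s ∈ p.support, (κ s : ZMod n) * ∏ o ∈ s.support,
        (o.elim ((α h).toAdd : ZMod n) fun i => (x i : ZMod n)) ^ s o := by
    intro h
    obtain ⟨y, rfl, -⟩ := ha.existsUnique_form h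
    have h1 : (D : ℤ) * cocycleVal σ (canonicalForm a x) (canonicalForm a y) =
        ∑ s ∈ p.support, κ s * ∏ o ∈ s.support, (o.elim (y 0) x) ^ s o := by
      have h2 : ((D : ℤ) * cocycleVal σ (canonicalForm a x) (canonicalForm a y) : ℚ) =
          ∑ s ∈ p.support, (κ s : ℚ) * ∏ o ∈ s.support, ((o.elim (y 0) x : ℤ) : ℚ) ^ s o := by
        rw [hp x y, polyVal, eval_eq, Finset.mul_sum]
        refine Finset.sum_congr rfl fun s hs => ?_
        rw [← mul_assoc, Int.cast_natCast, hκ s hs]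
        congr 1
        refine Finset.prod_congr rfl fun o _ => ?_
        cases o <;> rfl
      exact_mod_cast h2
    have h3 := congrArg (Int.cast : ℤ → ZMod n) h1
    push_cast at h3
    rw [h3, hα y, toAdd_ofAdd]
    refine Finset.sum_congr rfl fun s _ => ?_
    congr 1
    refine Finset.prod_congr rfl fun o _ => ?_
    cases o <;> rfl
  apply hunit.mul_left_cancel
  rw [key, key, hh]

/-- The maps `ρ_n` are the weighted shifts with weights `σ(g, ·)` modulo `n`. -/
theorem isCocycleMap_iff {σ : cocycles₂ (trivialInt Γ)}
    {p : MvPolynomial (Option (Fin (m + 1))) ℚ} (hp : IsGivenBy a σ p) (ha : IsMalcevBasis a)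
    (hα : IsCanonicalHom a α) {n : ℕ} [NeZero n] (hn : CoprimeToDenominators p n)
    (ρ : Γ → Matrix.unitaryGroup (ZMod n) ℂ) :
    IsCocycleMap a p n ρ ↔ ∀ g, (ρ g).1 =
      shiftMatrix ((α g).toAdd : ZMod n) (cocycleWeight (cocycleVal σ) (a 0) n g) := by
  have hweight := cocycleWeight_eq hα.apply_zero (hp.intCast_eq ha hα hn)
  have hcol : ∀ (x : Fin (m + 1) → ℤ) (j : ℤ),
      (shiftMatrix ((α (canonicalForm a x)).toAdd : ZMod n)
        (cocycleWeight (cocycleVal σ) (a 0) n (canonicalForm a x))).mulVec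
          (Pi.single (j : ZMod n) 1) =
      Complex.exp (2 * Real.pi * Complex.I / n * (polyVal p x j : ℂ)) •
        Pi.single ((j : ZMod n) + (x 0 : ZMod n)) (1 : ℂ) := by
    intro x j
    -- Every integer `j` is the first coordinate of a group element, so `p(x, j)` is a cocycle value
    -- and hence an integer.
    have hj : j = (α (canonicalForm a (Pi.single 0 j))).toAdd := by
      rw [hα, toAdd_ofAdd, Pi.single_eq_same]
    have h1 := hweight (canonicalForm a x) (canonicalForm a (Pi.single 0 j))
    rw [← hj] at h1
    have h2 := hp x (Pi.single 0 j)
    rw [Pi.single_eq_same] at h2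
    rw [shiftMatrix_mulVec_single, h1, ZMod.stdAddChar_coe, hα x, toAdd_ofAdd, ← h2]
    congr 2
    push_cast
    ring
  constructor
  · intro h g
    obtain ⟨x, rfl, -⟩ := ha.existsUnique_form g
    exact eq_of_mulVec_single fun j => (h x j).trans (hcol x j).symm
  · intro h x j
    rw [h]
    exact hcol x j

end Polynomial

end SkinnyClass

open SkinnyClass in
theorem mainTheorem3 {Γ : Type} [Group Γ] [Group.FG Γ] [Group.IsNilpotent Γ]
    (htf : ∀ g : Γ, g ≠ 1 → ¬ IsOfFinOrder g) :
    -- a non-torsion skinny class (with respect to any homomorphism to `ℤ`) obstructs stability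
    ((∃ (α : Γ →* Multiplicative ℤ) (c : groupCohomology.H2 (trivialInt Γ)),
        IsSkinny α c ∧ ¬ IsOfFinAddOrder c) → ¬ FrobeniusStable Γ) ∧
    -- the explicit sequence
    (∀ (m : ℕ) (a : Fin (m + 1) → Γ), IsMalcevBasis a →
      ∀ α : Γ →* Multiplicative ℤ, IsCanonicalHom a α →
      ∀ c : groupCohomology.H2 (trivialInt Γ), IsSkinny α c → ¬ IsOfFinAddOrder c →
        -- there is a polynomial representative
        (∃ (σ : groupCohomology.cocycles₂ (trivialInt Γ))
            (p : MvPolynomial (Option (Fin (m + 1))) ℚ),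
          groupCohomology.H2π (trivialInt Γ) σ = c ∧ IsNormalized σ ∧ IsGivenBy a σ p) ∧
        -- and for every polynomial representative
        ∀ (σ : groupCohomology.cocycles₂ (trivialInt Γ))
            (p : MvPolynomial (Option (Fin (m + 1))) ℚ),
          groupCohomology.H2π (trivialInt Γ) σ = c → IsGivenBy a σ p →
          -- the formula for `ρ_n` is well defined
          (∀ (n : ℕ) [NeZero n], CoprimeToDenominators p n →
            ∃! ρ : Γ → Matrix.unitaryGroup (ZMod n) ℂ, IsCocycleMap a p n ρ) ∧
          -- and along the admissible `n → ∞` it is a non-perturbable asymptotic representation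
          ∀ (n : ℕ → ℕ) [∀ i, NeZero (n i)], StrictMono n →
            (∀ i, CoprimeToDenominators p (n i)) →
            ∀ ρ : ∀ i, Γ → Matrix.unitaryGroup (ZMod (n i)) ℂ,
              (∀ i, IsCocycleMap a p (n i) (ρ i)) →
              IsFrobeniusAsymptoticRep ρ ∧ ¬ IsFrobeniusPerturbable ρ ∧
                ¬ IsOpNormPerturbable ρ) := by
  refine ⟨?_, ?_⟩
  · rintro ⟨α, c, hc, hct⟩
    exact not_frobeniusStable_of_isSkinny hc hct
  intro m a ha α hα c hc hct
  refine ⟨exists_polynomial_cocycle hα hc, ?_⟩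
  rintro σ p rfl hp
  refine ⟨fun n _ hn => ?_, fun n _ hmono hn ρ hρ => ?_⟩
  · refine ⟨fun g => ⟨_, shiftMatrix_mem_unitaryGroup _ _⟩,
      (isCocycleMap_iff hp ha hα hn _).2 fun _ => rfl, fun ρ hρ => funext fun g => ?_⟩
    exact Subtype.ext ((isCocycleMap_iff hp ha hα hn ρ).1 hρ g)
  have hmul := fun i => mul_eq_scalarUnitary_mul hα.apply_zero (cocycleVal_identity σ)
    (cocycleWeight_eq hα.apply_zero (hp.intCast_eq ha hα (hn i)))
    ((isCocycleMap_iff hp ha hα (hn i) (ρ i)).1 (hρ i))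
  have hcard : Filter.Tendsto (fun i => Fintype.card (ZMod (n i))) Filter.atTop Filter.atTop := by
    simpa only [ZMod.card] using hmono.tendsto_atTop
  have hop := not_isOpNormPerturbable hct hcard hmul
  exact ⟨isFrobeniusAsymptoticRep_of_scalar hcard hmul,
    fun h => hop h.isOpNormPerturbable, hop⟩
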